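/- Let $T>0$, $\ell>0$, $X=[0,\ell]$ and $p\in[1,\infty)$. Let $v\in C^1([0,T]\times\mathbb{R};\mathbb{R}_{>0})$, and let $b,d\in C^1(X;X)$ with $b\le d$. Given constants $0<\lambda_{\min}\le\lambda_{\max}$ and $L\ge 0$, let $\Lambda$ be the set of all $\lambda\in C([0,T]\times X\times\mathbb{R}_{\ge0};\mathbb{R})$ such that $\lambda_{\min}\le\lambda\le\lambda_{\max}$ and $$|\lambda(t,x,y)-\lambda(\tilde t,\tilde x,\tilde y)|\le L\big(|x-\tilde x|+|y-\tilde y|+|t-\tilde t|\big)$$ for all $t,\tilde t\in[0,T]$, $x,\tilde x\in X$, $y,\tilde y\in\mathbb{R}_{>0}$. Given $\rho_0,q_0\in L^\infty(X)$ and $u^1,u^2\in L^\infty((0,T))$ with $\rho_0\ge0$ and $u^1\ge0$ almost everywhere, consider for $\lambda\in\Lambda$ the system for the density $\rho$ of background traffic and the density $q$ of trucks $$\partial_t\rho(t,x)+\partial_x\Big(v\Big(t,\int_X\rho(t,s)\,ds\Big)\rho(t,x)\Big)=0,\qquad \partial_t q(t,x)+\partial_x\Big(\lambda\Big(t,x,\int_{b(x)}^{d(x)}\rho(t,s)\,ds\Big)q(t,x)\Big)=0$$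 on $(0,T)\times X$, with initial conditions $\rho(0,x)=\rho_0(x)$, $q(0,x)=q_0(x)$ for $x\in X$ and boundary conditions $$v\Big(t,\int_X\rho(t,s)\,ds\Big)\rho(t,0)=u^1(t),\qquad \lambda\Big(t,0,\int_{b(0)}^{d(0)}\rho(t,s)\,ds\Big)q(t,0)=u^2(t),\qquad t\in(0,T).$$ A weak solution is a pair $\rho,q\in C([0,T];L^p(X))$ such that for every $\varphi\in C^1$ with compact support in $[0,T)\times[0,\ell)$ and for $(r,c,r_0,u)$ equal to $\big(\rho,\;v(t,\int_X\rho(t,s)\,ds),\;\rho_0,\;u^1\big)$ and to $\big(q,\;\lambda(t,x,\int_{b(x)}^{d(x)}\rho(t,s)\,ds),\;q_0,\;u^2\big)$, $$\int_0^T\!\!\int_X r\,\big(\partial_t\varphi+c\,\partial_x\varphi\big)\,dx\,dt+\int_X r_0(x)\varphi(0,x)\,dx+\int_0^T u(t)\varphi(t,0)\,dt=0.$$ Theorem (well-posedness of the PDE system). For every $\lambda\in\Lambda$ and all such data the system has exactly one weak solution $(\rho,q)$ with $\rho,q\in C([0,T];L^p(X))$. Both $\rho$ and $q$ are essentially bounded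 on $(0,T)\times X$. Moreover $\rho\ge0$, and $q\ge0$ whenever $q_0\ge0$ and $u^2\ge0$ almost everywhere. -/

import Mathlib

open MeasureTheory Set
open scoped ENNReal

/-- The space `L^p(X)` over the road `X = [0, ℓ]`, with Lebesgue measure. -/
abbrev RoadLp (ℓ : ℝ) (p : ℝ≥0∞) : Type :=
  Lp ℝ p (volume.restrict (Icc (0 : ℝ) ℓ))

/-- The set of admissible truck speeds `λ(t, x, y)`, `(t, x, y) ∈ [0, T] × [0, ℓ] × [0, ∞)`:
continuous, between `lmin` and `lmax`, and Lipschitz with constant `L` for the `ℓ¹` distance.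
Values outside `[0, T] × [0, ℓ] × [0, ∞)` are irrelevant. -/
def admissibleSpeeds (T ℓ lmin lmax L : ℝ) : Set (ℝ → ℝ → ℝ → ℝ) :=
  {lam |
    ContinuousOn (fun z : ℝ × ℝ × ℝ => lam z.1 z.2.1 z.2.2)
      (Icc 0 T ×ˢ (Icc 0 ℓ ×ˢ Ici 0)) ∧
    (∀ t ∈ Icc 0 T, ∀ x ∈ Icc 0 ℓ, ∀ y ∈ Ici (0 : ℝ),
      lmin ≤ lam t x y ∧ lam t x y ≤ lmax) ∧
    (∀ t ∈ Icc 0 T, ∀ t' ∈ Icc 0 T, ∀ x ∈ Icc 0 ℓ, ∀ x' ∈ Icc 0 ℓ,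
      ∀ y ∈ Ioi (0 : ℝ), ∀ y' ∈ Ioi (0 : ℝ),
      |lam t x y - lam t' x' y'| ≤ L * (|x - x'| + |y - y'| + |t - t'|))}

/-- Test functions: restricted to `[0, T] × [0, ℓ]` these are the `C¹` functions with compact
support in `[0, T) × [0, ℓ)`; they need not vanish at `t = 0` or at `x = 0`.
The first coordinate is time, the second one is space. -/
def IsTestFunction (T ℓ : ℝ) (φ : ℝ × ℝ → ℝ) : Prop :=
  ContDiff ℝ 1 φ ∧ tsupport φ ⊆ Iio T ×ˢ Iio ℓ

/-- `r` satisfies, in the weak sense, the conservation law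
`∂ₜ r + ∂ₓ (c r) = 0` on `(0, T) × (0, ℓ)`, with initial condition `r(0, x) = r₀(x)` and inflow
condition `c(t, 0) r(t, 0) = u(t)`. -/
def SatisfiesWeakly {p : ℝ≥0∞} (T ℓ : ℝ) (c : ℝ → ℝ → ℝ) (r₀ u : ℝ → ℝ)
    (r : ℝ → RoadLp ℓ p) : Prop :=
  ∀ φ : ℝ × ℝ → ℝ, IsTestFunction T ℓ φ →
    (∫ t in (0 : ℝ)..T, ∫ x in (0 : ℝ)..ℓ,
        r t x * (fderiv ℝ φ (t, x) (1, 0) + c t x * fderiv ℝ φ (t, x) (0, 1)))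
      + (∫ x in (0 : ℝ)..ℓ, r₀ x * φ (0, x))
      + (∫ t in (0 : ℝ)..T, u t * φ (t, 0)) = 0

/-- `(ρ, q)` is a weak solution in `C([0, T]; L^p(X))` of the coupled system, `X = [0, ℓ]`:
* background traffic, with speed `v(t, ∫_X ρ(t, s) ds)`, initial density `ρ₀`, inflow `u₁`;
* trucks, with speed `λ(t, x, ∫_{b(x)}^{d(x)} ρ(t, s) ds)`, initial density `q₀`, inflow `u₂`.

As functions of time `ρ` and `q` matter only on `[0, T]`. -/
structure IsWeakSolution {p : ℝ≥0∞} [Fact (1 ≤ p)] (T ℓ : ℝ) (v : ℝ → ℝ → ℝ)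
    (lam : ℝ → ℝ → ℝ → ℝ) (b d ρ₀ q₀ u₁ u₂ : ℝ → ℝ) (ρ q : ℝ → RoadLp ℓ p) : Prop where
  continuous_traffic : ContinuousOn ρ (Icc 0 T)
  continuous_truck : ContinuousOn q (Icc 0 T)
  traffic : SatisfiesWeakly T ℓ (fun t _ => v t (∫ s in (0 : ℝ)..ℓ, ρ t s)) ρ₀ u₁ ρ
  truck : SatisfiesWeakly T ℓ (fun t x => lam t x (∫ s in (b x)..(d x), ρ t s)) q₀ u₂ q

/-- Essential boundedness over space and time. For `r ∈ C([0, T]; L^p(X))` a bound at almost every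
time holds at every time. -/
def IsEssBounded {p : ℝ≥0∞} (T ℓ : ℝ) (r : ℝ → RoadLp ℓ p) : Prop :=
  ∃ M : ℝ, ∀ t ∈ Icc 0 T, ∀ᵐ x ∂(volume.restrict (Icc (0 : ℝ) ℓ)), |r t x| ≤ M

/-!
The speed of the background traffic depends on `ρ` only through its mass `m(t)`, so its
characteristics are the translates of one curve, and mass conservation expresses `m(t)` through the
data and the distance travelled since time `0`. This is a Volterra fixed-point equation for `m`
alone; solving it and transporting the data along the characteristics gives `ρ`. Once `ρ` is known,
the trucks obey a linear conservation law with a positive speed that is Lipschitz in space, which is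
again solved by transport. The inflow is turned into initial data on `x < 0`: a vehicle that enters
at time `t` is started at `x = -∫₀ᵗ c(s, 0) ds`.

For uniqueness, let `D(t, x)` be the primitive in `x` of the difference of two weak solutions. It
satisfies `∂ₜ D + c₁ ∂ₓ D = (c₂ - c₁) r₂`, with a source that is controlled by the difference of the
masses, that is by `D(t, ℓ)`. The energy `∫ D²` is differentiable in time, and since the speed is
positive at the outlet, its derivative contains the loss term `-c₁ D(t, ℓ)²`, which absorbs the
source. Grönwall's inequality then gives `D = 0`.
-/

namespace RoadTraffic

open Filter Topology NNReal

/-! ### Continuous families of integrable functions -/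

section L1Continuity

variable {ι : Type*} [TopologicalSpace ι] {S : Set ι} {a b : ℝ} {r f : ι → ℝ → ℝ}

/-- Continuity along `S` of a family of functions with values in `L¹(a, b)`, stated for
representatives so that the family can be manipulated pointwise. -/
def ContinuousInL1On (S : Set ι) (a b : ℝ) (r : ι → ℝ → ℝ) : Prop :=
  ∀ s ∈ S, IntervalIntegrable (r s) volume a b ∧
    Tendsto (fun t => ∫ x in a..b, |r t x - r s x|) (𝓝[S] s) (𝓝 0)

lemma continuousOn_section {c : ι → ℝ → ℝ} {X : Set ℝ}
    (hc : ContinuousOn (fun z : ι × ℝ => c z.1 z.2) (S ×ˢ X)) {t : ι} (ht : t ∈ S) :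
    ContinuousOn (c t) X :=
  hc.comp (f := fun x => (t, x)) (by fun_prop) fun _ hx => ⟨ht, hx⟩

lemma intervalIntegrable_of_continuousOn_Icc (hab : a ≤ b) {g : ℝ → ℝ}
    (hg : ContinuousOn g (Icc a b)) : IntervalIntegrable g volume a b :=
  ContinuousOn.intervalIntegrable (by rwa [uIcc_of_le hab])

lemma intervalIntegrable_continuousOn_mul (hab : a ≤ b) {c g : ℝ → ℝ}
    (hc : ContinuousOn c (Icc a b)) (hg : IntervalIntegrable g volume a b) :
    IntervalIntegrable (fun x => c x * g x) volume a b :=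
  hg.continuousOn_mul (by rwa [uIcc_of_le hab])

lemma continuousOn_primitive (hab : a ≤ b) {g : ℝ → ℝ} (hg : IntervalIntegrable g volume a b) :
    ContinuousOn (fun x => ∫ y in a..x, g y) (Icc a b) := by
  simpa only [uIcc_of_le hab] using
    intervalIntegral.continuousOn_primitive_interval' hg left_mem_uIcc

lemma tendsto_integral_abs_mul_of_continuousOn (hab : a ≤ b) {c : ι → ℝ → ℝ} {g : ℝ → ℝ}
    (hc : ContinuousOn (fun z : ι × ℝ => c z.1 z.2) (S ×ˢ Icc a b))
    (hg : IntervalIntegrable g volume a b) {s : ι} (hs : s ∈ S) :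
    Tendsto (fun t => ∫ x in a..b, |c t x - c s x| * |g x|) (𝓝[S] s) (𝓝 0) := by
  have hnonneg : ∀ t, 0 ≤ ∫ x in a..b, |c t x - c s x| * |g x| := fun t =>
    intervalIntegral.integral_nonneg hab fun _ _ => by positivity
  have hI : 0 ≤ ∫ x in a..b, |g x| := intervalIntegral.integral_nonneg hab fun _ _ => abs_nonneg _
  rw [Metric.tendsto_nhds]
  intro ε hε
  set δ := ε / ((∫ x in a..b, |g x|) + 1)
  have hδ0 : 0 < δ := by positivity
  obtain ⟨V, hV, hVδ⟩ := isCompact_Icc.mem_uniformity_of_prod hc hs (Metric.dist_mem_uniformity hδ0)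
  filter_upwards [hV, self_mem_nhdsWithin] with t htV ht
  rw [Real.dist_0_eq_abs, abs_of_nonneg (hnonneg t)]
  calc ∫ x in a..b, |c t x - c s x| * |g x|
      ≤ ∫ x in a..b, δ * |g x| := by
        refine intervalIntegral.integral_mono_on hab (intervalIntegrable_continuousOn_mul hab
          ((continuousOn_section hc ht).sub (continuousOn_section hc hs)).abs hg.abs)
          (hg.abs.const_mul δ) fun x hx => ?_
        gcongr
        exact (hVδ t htV x hx).le
    _ < δ * ((∫ x in a..b, |g x|) + 1) := by
        rw [intervalIntegral.integral_const_mul]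
        gcongr
        exact lt_add_one _
    _ = ε := div_mul_cancel₀ ε (by positivity)

namespace ContinuousInL1On

lemma intervalIntegrable (hr : ContinuousInL1On S a b r) {s : ι} (hs : s ∈ S) :
    IntervalIntegrable (r s) volume a b :=
  (hr s hs).1

lemma tendsto (hr : ContinuousInL1On S a b r) {s : ι} (hs : s ∈ S) :
    Tendsto (fun t => ∫ x in a..b, |r t x - r s x|) (𝓝[S] s) (𝓝 0) :=
  (hr s hs).2

lemma mono {S' : Set ι} (hr : ContinuousInL1On S a b r) (h : S' ⊆ S) :
    ContinuousInL1On S' a b r := fun s hs =>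
  ⟨hr.intervalIntegrable (h hs), (hr.tendsto (h hs)).mono_left (nhdsWithin_mono s h)⟩

lemma comp {κ : Type*} [TopologicalSpace κ] {S' : Set κ} {g : κ → ι}
    (hr : ContinuousInL1On S a b r) (hg : ContinuousOn g S') (hgS : MapsTo g S' S) :
    ContinuousInL1On S' a b (fun k => r (g k)) := fun _ hk =>
  ⟨hr.intervalIntegrable (hgS hk),
    (hr.tendsto (hgS hk)).comp (hg.continuousWithinAt hk |>.tendsto_nhdsWithin hgS)⟩

lemma of_integral_abs_sub_le (hab : a ≤ b) {B : ι → ι → ℝ}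
    (hr : ∀ s ∈ S, IntervalIntegrable (r s) volume a b)
    (hB : ∀ s ∈ S, Tendsto (B s) (𝓝[S] s) (𝓝 0))
    (h : ∀ s ∈ S, ∀ᶠ t in 𝓝[S] s, ∫ x in a..b, |r t x - r s x| ≤ B s t) :
    ContinuousInL1On S a b r := fun s hs =>
  ⟨hr s hs, squeeze_zero' (Eventually.of_forall fun _ =>
    intervalIntegral.integral_nonneg hab fun _ _ => abs_nonneg _) (h s hs) (hB s hs)⟩

lemma abs (hab : a ≤ b) (hr : ContinuousInL1On S a b r) :
    ContinuousInL1On S a b (fun t x => |r t x|) :=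
  .of_integral_abs_sub_le hab (fun _ hs => (hr.intervalIntegrable hs).abs)
    (fun _ hs => hr.tendsto hs) fun _ hs => eventually_mem_nhdsWithin.mono fun _ ht =>
      intervalIntegral.integral_mono_on hab
        ((hr.intervalIntegrable ht).abs.sub (hr.intervalIntegrable hs).abs).abs
        ((hr.intervalIntegrable ht).sub (hr.intervalIntegrable hs)).abs
        fun _ _ => abs_abs_sub_abs_le _ _

lemma sub (hab : a ≤ b) (hr : ContinuousInL1On S a b r) (hf : ContinuousInL1On S a b f) :
    ContinuousInL1On S a b (fun t x => r t x - f t x) := by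
  refine .of_integral_abs_sub_le hab (B := fun s t => (∫ x in a..b, |r t x - r s x|)
    + ∫ x in a..b, |f t x - f s x|)
    (fun s hs => (hr.intervalIntegrable hs).sub (hf.intervalIntegrable hs))
    (fun s hs => by simpa only [add_zero] using (hr.tendsto hs).add (hf.tendsto hs))
    fun s hs => eventually_mem_nhdsWithin.mono fun t ht => ?_
  have hr' := (hr.intervalIntegrable ht).sub (hr.intervalIntegrable hs)
  have hf' := (hf.intervalIntegrable ht).sub (hf.intervalIntegrable hs)
  rw [← intervalIntegral.integral_add hr'.abs hf'.abs]
  refine intervalIntegral.integral_mono_on hab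
    (((hr.intervalIntegrable ht).sub (hf.intervalIntegrable ht)).sub
      ((hr.intervalIntegrable hs).sub (hf.intervalIntegrable hs))).abs
    (hr'.abs.add hf'.abs) fun x _ => ?_
  rw [sub_sub_sub_comm]
  exact abs_sub _ _

lemma continuousOn_mul (hab : a ≤ b) {c : ι → ℝ → ℝ}
    (hc : ContinuousOn (fun z : ι × ℝ => c z.1 z.2) (S ×ˢ Icc a b))
    (hr : ContinuousInL1On S a b r) : ContinuousInL1On S a b (fun t x => c t x * r t x) := by
  have hcr : ∀ s ∈ S, ∀ t ∈ S, IntervalIntegrable (fun x => c s x * r t x) volume a b :=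
    fun s hs t ht => intervalIntegrable_continuousOn_mul hab (continuousOn_section hc hs)
      (hr.intervalIntegrable ht)
  choose! C hC using fun s (hs : s ∈ S) =>
    isCompact_Icc.exists_bound_of_continuousOn (continuousOn_section hc hs)
  refine .of_integral_abs_sub_le hab (B := fun s t => (C s + 1) * (∫ x in a..b, |r t x - r s x|)
    + ∫ x in a..b, |c t x - c s x| * |r s x|) (fun s hs => hcr s hs s hs) (fun s hs => ?_)
    fun s hs => ?_
  · simpa only [mul_zero, add_zero] using ((hr.tendsto hs).const_mul (C s + 1)).add
      (tendsto_integral_abs_mul_of_continuousOn hab hc (hr.intervalIntegrable hs) hs)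
  obtain ⟨V, hV, hV1⟩ :=
    isCompact_Icc.mem_uniformity_of_prod hc hs (Metric.dist_mem_uniformity one_pos)
  filter_upwards [hV, self_mem_nhdsWithin] with t htV ht
  have h1 := (((hr.intervalIntegrable ht).sub (hr.intervalIntegrable hs)).abs).const_mul (C s + 1)
  have h2 : IntervalIntegrable (fun x => |c t x - c s x| * |r s x|) volume a b :=
    intervalIntegrable_continuousOn_mul hab
      ((continuousOn_section hc ht).sub (continuousOn_section hc hs)).abs
      (hr.intervalIntegrable hs).abs
  rw [← intervalIntegral.integral_const_mul, ← intervalIntegral.integral_add h1 h2]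
  refine intervalIntegral.integral_mono_on hab ((hcr t ht t ht).sub (hcr s hs s hs)).abs
    (h1.add h2) fun x hx => ?_
  have hct : |c t x| ≤ C s + 1 := by
    have hdist : |c t x - c s x| < 1 := hV1 t htV x hx
    have hcs : |c s x| ≤ C s := hC s hs x hx
    linarith [abs_sub_abs_le_abs_sub (c t x) (c s x)]
  calc |c t x * r t x - c s x * r s x|
      = |c t x * (r t x - r s x) + (c t x - c s x) * r s x| := by ring_nf
    _ ≤ |c t x| * |r t x - r s x| + |c t x - c s x| * |r s x| := by
        rw [← abs_mul, ← abs_mul]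
        exact abs_add_le _ _
    _ ≤ (C s + 1) * |r t x - r s x| + |c t x - c s x| * |r s x| := by gcongr

lemma mul_const (hab : a ≤ b) (hr : ContinuousInL1On S a b r) {γ : ℝ → ℝ}
    (hγ : ContinuousOn γ (Icc a b)) : ContinuousInL1On S a b (fun t x => r t x * γ x) := by
  simpa only [mul_comm] using hr.continuousOn_mul hab (c := fun _ x => γ x)
    (hγ.comp (f := Prod.snd) (by fun_prop) fun z hz => hz.2)

lemma abs_primitive_sub_le (hab : a ≤ b) (hr : ContinuousInL1On S a b r) {s t : ι}
    (hs : s ∈ S) (ht : t ∈ S) {x : ℝ} (hx : x ∈ Icc a b) :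
    |(∫ y in a..x, r t y) - ∫ y in a..x, r s y| ≤ ∫ y in a..b, |r t y - r s y| := by
  have hsub : uIcc a x ⊆ uIcc a b := uIcc_subset_uIcc_left (by rwa [uIcc_of_le hab])
  rw [← intervalIntegral.integral_sub ((hr.intervalIntegrable ht).mono_set hsub)
    ((hr.intervalIntegrable hs).mono_set hsub)]
  exact (intervalIntegral.abs_integral_le_integral_abs hx.1).trans
    (intervalIntegral.integral_mono_interval le_rfl hx.1 hx.2
      (Eventually.of_forall fun _ => abs_nonneg _)
      ((hr.intervalIntegrable ht).sub (hr.intervalIntegrable hs)).abs)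

lemma continuousOn_primitive (hab : a ≤ b) (hr : ContinuousInL1On S a b r) :
    ContinuousOn (fun z : ι × ℝ => ∫ y in a..z.2, r z.1 y) (S ×ˢ Icc a b) := by
  rintro ⟨s, x⟩ ⟨hs, hx⟩
  have htime : Tendsto (fun z : ι × ℝ => (∫ y in a..z.2, r z.1 y) - ∫ y in a..z.2, r s y)
      (𝓝[S ×ˢ Icc a b] (s, x)) (𝓝 0) :=
    squeeze_zero_norm' (eventually_mem_nhdsWithin.mono fun z hz =>
      hr.abs_primitive_sub_le hab hs hz.1 hz.2)
      ((hr.tendsto hs).comp (tendsto_nhdsWithin_iff.2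
        ⟨(continuous_fst.tendsto (s, x)).mono_left nhdsWithin_le_nhds,
          eventually_mem_nhdsWithin.mono fun z hz => hz.1⟩))
  have hspace : Tendsto (fun z : ι × ℝ => ∫ y in a..z.2, r s y)
      (𝓝[S ×ˢ Icc a b] (s, x)) (𝓝 (∫ y in a..x, r s y)) :=
    (RoadTraffic.continuousOn_primitive hab (hr.intervalIntegrable hs)).comp
      continuousOn_snd (fun z hz => hz.2) (s, x) ⟨hs, hx⟩
  simpa only [ContinuousWithinAt, sub_add_cancel, zero_add] using htime.add hspace

lemma continuousOn_integral (hab : a ≤ b) (hr : ContinuousInL1On S a b r) :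
    ContinuousOn (fun t => ∫ x in a..b, r t x) S :=
  (hr.continuousOn_primitive hab).comp (f := fun t => (t, b)) (by fun_prop)
    fun _ ht => ⟨ht, right_mem_Icc.2 hab⟩

end ContinuousInL1On

section Lp

variable {p : ℝ≥0∞}

lemma intervalIntegral_eq_integral_Icc (hab : a ≤ b) (g : ℝ → ℝ) :
    ∫ x in a..b, g x = ∫ x in Icc a b, g x := by
  rw [intervalIntegral.integral_of_le hab, integral_Icc_eq_integral_Ioc]

lemma ofReal_integral_abs_eq_eLpNorm_one (hab : a ≤ b) {g : ℝ → ℝ}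
    (hg : IntervalIntegrable g volume a b) :
    ENNReal.ofReal (∫ x in a..b, |g x|) = eLpNorm g 1 (volume.restrict (Icc a b)) := by
  rw [intervalIntegral_eq_integral_Icc hab, eLpNorm_one_eq_lintegral_enorm]
  exact ofReal_integral_norm_eq_lintegral_enorm
    ((intervalIntegrable_iff_integrableOn_Icc_of_le hab).1 hg)

lemma intervalIntegrable_of_memLp (hab : a ≤ b) (hp : 1 ≤ p) {g : ℝ → ℝ}
    (hg : MemLp g p (volume.restrict (Icc a b))) : IntervalIntegrable g volume a b :=
  (intervalIntegrable_iff_integrableOn_Icc_of_le hab).2 (hg.integrable hp)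

lemma eLpNorm_rpow_le_of_abs_le {α : Type*} [MeasurableSpace α] {μ : Measure α} (hp : 1 ≤ p)
    (hp' : p ≠ ⊤) {g : α → ℝ} {M : ℝ} (hM : ∀ x, |g x| ≤ M) :
    eLpNorm g p μ ^ p.toReal ≤ ENNReal.ofReal M ^ (p.toReal - 1) * eLpNorm g 1 μ := by
  have hp1 : 1 ≤ p.toReal := by simpa only [ENNReal.toReal_one] using ENNReal.toReal_mono hp' hp
  rw [eLpNorm_eq_lintegral_rpow_enorm_toReal (zero_lt_one.trans_le hp).ne' hp',
    ← ENNReal.rpow_mul, one_div_mul_cancel (zero_lt_one.trans_le hp1).ne', ENNReal.rpow_one,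
    eLpNorm_one_eq_lintegral_enorm, ← lintegral_const_mul' _ _
      (ENNReal.rpow_ne_top_of_nonneg (sub_nonneg.2 hp1) ENNReal.ofReal_ne_top)]
  refine lintegral_mono fun x => ?_
  calc ‖g x‖ₑ ^ p.toReal = ‖g x‖ₑ ^ (p.toReal - 1) * ‖g x‖ₑ := by
        conv_lhs => rw [← sub_add_cancel p.toReal 1]
        rw [ENNReal.rpow_add_of_nonneg _ _ (sub_nonneg.2 hp1) zero_le_one, ENNReal.rpow_one]
    _ ≤ ENNReal.ofReal M ^ (p.toReal - 1) * ‖g x‖ₑ := by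
        gcongr
        rw [Real.enorm_eq_ofReal_abs]
        exact ENNReal.ofReal_le_ofReal (hM x)

lemma continuousInL1On_of_continuousOn_Lp [Fact (1 ≤ p)] (hab : a ≤ b)
    {r : ι → Lp ℝ p (volume.restrict (Icc a b))} (hr : ContinuousOn r S) :
    ContinuousInL1On S a b (fun t x => r t x) := by
  have hint : ∀ t, IntervalIntegrable (r t) volume a b := fun t =>
    intervalIntegrable_of_memLp hab Fact.out (Lp.memLp (r t))
  refine fun s hs => ⟨hint s, ?_⟩
  let μ := volume.restrict (Icc a b)
  let C := μ univ ^ (1 / (1 : ℝ≥0∞).toReal - 1 / p.toReal)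
  have hC : C ≠ ⊤ := by
    refine ENNReal.rpow_ne_top_of_nonneg (sub_nonneg.2 ?_) (measure_ne_top _ _)
    rcases eq_or_ne p ⊤ with rfl | hp
    · simp
    · have : 1 ≤ p.toReal := by
        simpa only [ENNReal.toReal_one] using ENNReal.toReal_mono hp (Fact.out : 1 ≤ p)
      rw [ENNReal.toReal_one]
      gcongr
  have hbound : Tendsto (fun t => eLpNorm (⇑(r t) - ⇑(r s)) p μ * C) (𝓝[S] s) (𝓝 0) := by
    simpa only [zero_mul] using ENNReal.Tendsto.mul_const
      ((Lp.tendsto_Lp_iff_tendsto_eLpNorm' _ _).1 (hr s hs)) (Or.inr hC)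
  have hL1 : Tendsto (fun t => eLpNorm (fun x => r t x - r s x) 1 μ) (𝓝[S] s) (𝓝 0) :=
    tendsto_of_tendsto_of_tendsto_of_le_of_le tendsto_const_nhds hbound (fun _ => zero_le)
      fun t => eLpNorm_le_eLpNorm_mul_rpow_measure_univ Fact.out
        ((Lp.aestronglyMeasurable _).sub (Lp.aestronglyMeasurable _))
  refine ((ENNReal.tendsto_toReal ENNReal.zero_ne_top).comp hL1).congr fun t => ?_
  rw [Function.comp_apply, ← ofReal_integral_abs_eq_eLpNorm_one hab ((hint t).sub (hint s)),
    ENNReal.toReal_ofReal (intervalIntegral.integral_nonneg hab fun _ _ => abs_nonneg _)]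

lemma ContinuousInL1On.continuousOn_toLp [Fact (1 ≤ p)] (hp : p ≠ ⊤) (hab : a ≤ b)
    (hr : ContinuousInL1On S a b r) (hLp : ∀ t, MemLp (r t) p (volume.restrict (Icc a b)))
    {M : ℝ} (hM : ∀ t ∈ S, ∀ x, |r t x| ≤ M) : ContinuousOn (fun t => (hLp t).toLp (r t)) S := by
  intro s hs
  have hp0 : 0 < p.toReal := ENNReal.toReal_pos (zero_lt_one.trans_le Fact.out).ne' hp
  have hp1 : 0 ≤ p.toReal - 1 := sub_nonneg.2 <| by
    simpa only [ENNReal.toReal_one] using ENNReal.toReal_mono hp (Fact.out : 1 ≤ p)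
  rw [ContinuousWithinAt, Lp.tendsto_Lp_iff_tendsto_eLpNorm'']
  set C : ℝ≥0∞ := ENNReal.ofReal (M + M) ^ (p.toReal - 1)
  have hbound : Tendsto (fun t => (C * ENNReal.ofReal (∫ x in a..b, |r t x - r s x|))
      ^ p.toReal⁻¹) (𝓝[S] s) (𝓝 0) := by
    have := (ENNReal.Tendsto.const_mul (a := C) (ENNReal.tendsto_ofReal (hr.tendsto hs))
      (Or.inr (ENNReal.rpow_ne_top_of_nonneg hp1 ENNReal.ofReal_ne_top))).ennrpow_const p.toReal⁻¹
    simpa only [ENNReal.ofReal_zero, mul_zero, ENNReal.zero_rpow_of_pos (inv_pos.2 hp0)] using this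
  refine tendsto_of_tendsto_of_tendsto_of_le_of_le' tendsto_const_nhds hbound
    (Eventually.of_forall fun _ => zero_le) (eventually_mem_nhdsWithin.mono fun t ht => ?_)
  rw [ENNReal.le_rpow_inv_iff hp0, ofReal_integral_abs_eq_eLpNorm_one hab
    ((hr.intervalIntegrable ht).sub (hr.intervalIntegrable hs))]
  exact eLpNorm_rpow_le_of_abs_le Fact.out hp fun x =>
    (abs_sub _ _).trans (add_le_add (hM t ht x) (hM s hs x))

end Lp

end L1Continuity

/-! ### Primitives and separated test functions -/

section Primitives

variable {a b B : ℝ} {γ : ℝ → ℝ}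

lemma hasDerivAt_integral_of_continuous (hγ : Continuous γ) (B x : ℝ) :
    HasDerivAt (fun x => ∫ y in B..x, γ y) (γ x) x :=
  (hγ.integral_hasStrictDerivAt B x).hasDerivAt

lemma contDiff_integral_of_continuous (hγ : Continuous γ) (B : ℝ) :
    ContDiff ℝ 1 (fun x => ∫ y in B..x, γ y) := by
  rw [contDiff_one_iff_deriv, funext (hγ.deriv_integral γ B)]
  exact ⟨fun x => (hasDerivAt_integral_of_continuous hγ B x).differentiableAt, hγ⟩

lemma tsupport_integral_subset (hγ : tsupport γ ⊆ Iio B) :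
    tsupport (fun x => ∫ y in B..x, γ y) ⊆ Iio B := by
  obtain ⟨b', hb', hsub⟩ := exists_Ioc_subset_of_mem_nhds
    ((isClosed_tsupport γ).isOpen_compl.mem_nhds fun h => lt_irrefl B (hγ h)) ⟨B - 1, by simp⟩
  refine (closure_minimal (t := Iic b') (fun x hx => ?_) isClosed_Iic).trans
    (Iic_subset_Iio.2 hb')
  by_contra hxb
  rw [mem_Iic, not_le] at hxb
  refine hx (intervalIntegral.integral_zero_ae (Eventually.of_forall fun y hy =>
    image_eq_zero_of_notMem_tsupport fun hy' => ?_))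
  exact hsub ⟨(le_min hb'.le hxb.le).trans_lt hy.1, (hγ hy').le⟩ hy'

lemma integral_mul_eq_neg_integral_primitive_mul_deriv {g β : ℝ → ℝ}
    (hg : IntervalIntegrable g volume a b) (hβ : ContDiff ℝ 1 β) (hβb : β b = 0) :
    ∫ x in a..b, g x * β x = -∫ x in a..b, (∫ y in a..x, g y) * deriv β x := by
  have hparts := (hβ.contDiffOn.absolutelyContinuousOnInterval (a := a)
    (b := b)).integral_mul_deriv_eq_deriv_mul
      (hg.absolutelyContinuousOnInterval_intervalIntegral left_mem_uIcc)
  simp only [intervalIntegral.integral_same, hβb, zero_mul, mul_zero, sub_zero, zero_sub] at hparts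
  simp only [mul_comm _ (deriv β _), ← hparts]
  refine intervalIntegral.integral_congr_ae ?_
  filter_upwards [hg.ae_hasDerivAt_integral] with x hx hx'
  rw [(hx (uIoc_subset_uIcc hx') a left_mem_uIcc).deriv, mul_comm]

lemma eqOn_integral_of_weak_derivative (hab : a < b) {h k : ℝ → ℝ}
    (hh : ContinuousOn h (Icc a b)) (hk : ContinuousOn k (Icc a b))
    (H : ∀ α : ℝ → ℝ, ContDiff ℝ 1 α → tsupport α ⊆ Iio b →
      ∫ t in a..b, (deriv α t * h t + α t * k t) = 0) :
    EqOn h (fun t => ∫ s in a..t, k s) (Icc a b) := by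
  set K : ℝ → ℝ := fun t => ∫ s in a..t, k s
  have hkint := intervalIntegrable_of_continuousOn_Icc hab.le hk
  have hK : ContinuousOn K (Icc a b) := continuousOn_primitive hab.le hkint
  have horth : ∀ η : ℝ → ℝ, Continuous η → tsupport η ⊆ Iio b →
      ∫ t in a..b, η t * (h t - K t) = 0 := by
    intro η hη hηb
    set α : ℝ → ℝ := fun t => ∫ s in b..t, η s
    have hα : ContDiff ℝ 1 α := contDiff_integral_of_continuous hη b
    have hαη : deriv α = η := funext (hη.deriv_integral η b)
    have hint : ∀ f : ℝ → ℝ, ContinuousOn f (Icc a b) →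
        IntervalIntegrable (fun t => η t * f t) volume a b := fun f hf =>
      intervalIntegrable_of_continuousOn_Icc hab.le (hη.continuousOn.mul hf)
    have hαk : IntervalIntegrable (fun t => α t * k t) volume a b :=
      intervalIntegrable_of_continuousOn_Icc hab.le (hα.continuous.continuousOn.mul hk)
    have hparts : ∫ t in a..b, α t * k t = -∫ t in a..b, η t * K t := by
      simpa only [hαη, mul_comm] using
        integral_mul_eq_neg_integral_primitive_mul_deriv hkint hα intervalIntegral.integral_same
    have hweak := H α hα (tsupport_integral_subset hηb)
    rw [hαη, intervalIntegral.integral_add (hint h hh) hαk, hparts] at hweak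
    simp only [mul_sub]
    rw [intervalIntegral.integral_sub (hint h hh) (hint K hK)]
    exact hweak
  have hae : ∀ᵐ t, t ∈ Ioo a b → h t - K t = 0 := by
    refine isOpen_Ioo.ae_eq_zero_of_integral_contDiff_smul_eq_zero
      (((hh.sub hK).mono Ioo_subset_Icc_self).locallyIntegrableOn measurableSet_Ioo)
      fun η hη _ hηab => ?_
    simp only [smul_eq_mul]
    rw [← setIntegral_eq_integral_of_forall_compl_eq_zero (s := Ioc a b) fun t ht => by
      rw [image_eq_zero_of_notMem_tsupport fun ht' => ht (Ioo_subset_Ioc_self (hηab ht')),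
        zero_mul], ← intervalIntegral.integral_of_le hab.le]
    exact horth η hη.continuous (hηab.trans Ioo_subset_Iio_self)
  refine Measure.eqOn_Icc_of_ae_eq volume hab.ne ?_ hh hK
  rw [← Measure.restrict_congr_set Ioo_ae_eq_Icc, EventuallyEq,
    ae_restrict_iff' measurableSet_Ioo]
  filter_upwards [hae] with t ht ht' using sub_eq_zero.1 (ht ht')

end Primitives

section TestFunctions

variable {T ℓ : ℝ} {α β : ℝ → ℝ}

lemma isTestFunction_mul (hα : ContDiff ℝ 1 α) (hβ : ContDiff ℝ 1 β)
    (hα' : tsupport α ⊆ Iio T) (hβ' : tsupport β ⊆ Iio ℓ) :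
    IsTestFunction T ℓ (fun z => α z.1 * β z.2) := by
  refine ⟨(hα.comp contDiff_fst).mul (hβ.comp contDiff_snd), Subset.trans (closure_minimal
    (t := tsupport α ×ˢ tsupport β) (fun z hz => ?_)
    ((isClosed_tsupport _).prod (isClosed_tsupport _))) (prod_mono hα' hβ')⟩
  exact ⟨subset_tsupport _ (left_ne_zero_of_mul hz), subset_tsupport _ (right_ne_zero_of_mul hz)⟩

lemma fderiv_fst_mul_snd_apply {t x : ℝ} (hα : DifferentiableAt ℝ α t)
    (hβ : DifferentiableAt ℝ β x) (τ ξ : ℝ) :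
    fderiv ℝ (fun z : ℝ × ℝ => α z.1 * β z.2) (t, x) (τ, ξ)
      = deriv α t * τ * β x + α t * (deriv β x * ξ) := by
  have h1 : HasFDerivAt (fun z : ℝ × ℝ => α z.1) _ (t, x) :=
    hα.hasDerivAt.hasFDerivAt.comp (t, x) hasFDerivAt_fst
  have h2 : HasFDerivAt (fun z : ℝ × ℝ => β z.2) _ (t, x) :=
    hβ.hasDerivAt.hasFDerivAt.comp (t, x) hasFDerivAt_snd
  rw [(h1.fun_mul h2).fderiv]
  simp
  ring

end TestFunctions

/-! ### The primitive of a weakly conserved density -/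

section WeaklyConserved

variable {T ℓ : ℝ} {r f : ℝ → ℝ → ℝ} {γ : ℝ → ℝ}

/-- The weak form of `∂ₜ r + ∂ₓ f = 0` with vanishing initial and inflow data; a difference of two
solutions satisfies it with `f` the difference of the fluxes. -/
def WeaklyConserved (T ℓ : ℝ) (r f : ℝ → ℝ → ℝ) : Prop :=
  ∀ φ : ℝ × ℝ → ℝ, IsTestFunction T ℓ φ →
    ∫ t in (0 : ℝ)..T, ∫ x in (0 : ℝ)..ℓ,
      (r t x * fderiv ℝ φ (t, x) (1, 0) + f t x * fderiv ℝ φ (t, x) (0, 1)) = 0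

lemma WeaklyConserved.integral_primitive_mul_of_tsupport_subset (hT : 0 < T) (hℓ : 0 < ℓ)
    (hr : ContinuousInL1On (Icc 0 T) 0 ℓ r) (hf : ContinuousInL1On (Icc 0 T) 0 ℓ f)
    (hw : WeaklyConserved T ℓ r f) (hγ : Continuous γ) (hγℓ : tsupport γ ⊆ Iio ℓ) {t : ℝ}
    (ht : t ∈ Icc 0 T) :
    ∫ x in (0 : ℝ)..ℓ, (∫ y in (0 : ℝ)..x, r t y) * γ x
      = -∫ σ in (0 : ℝ)..t, ∫ x in (0 : ℝ)..ℓ, f σ x * γ x := by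
  set β : ℝ → ℝ := fun x => ∫ y in ℓ..x, γ y
  have hβ : ContDiff ℝ 1 β := contDiff_integral_of_continuous hγ ℓ
  have hβγ : deriv β = γ := funext (hγ.deriv_integral γ ℓ)
  have hrβ := hr.mul_const hℓ.le hβ.continuous.continuousOn
  have hfγ := hf.mul_const hℓ.le hγ.continuousOn
  have hmoment := eqOn_integral_of_weak_derivative hT (hrβ.continuousOn_integral hℓ.le)
    (hfγ.continuousOn_integral hℓ.le) fun α hα hαT => by
      refine Eq.trans ?_ (hw _ (isTestFunction_mul hα hβ hαT (tsupport_integral_subset hγℓ)))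
      refine intervalIntegral.integral_congr fun t ht => ?_
      rw [uIcc_of_le hT.le] at ht
      rw [← intervalIntegral.integral_const_mul, ← intervalIntegral.integral_const_mul,
        ← intervalIntegral.integral_add ((hrβ.intervalIntegrable ht).const_mul _)
          ((hfγ.intervalIntegrable ht).const_mul _)]
      refine intervalIntegral.integral_congr fun x _ => ?_
      simp only [fderiv_fst_mul_snd_apply (hα.differentiable one_ne_zero t)
        (hβ.differentiable one_ne_zero x), hβγ]
      ring
  have hparts := integral_mul_eq_neg_integral_primitive_mul_deriv (hr.intervalIntegrable ht) hβ
    intervalIntegral.integral_same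
  rw [hβγ] at hparts
  exact neg_eq_iff_eq_neg.1 (hparts.symm.trans (hmoment ht))

/-- Continuous cutoffs equal to `0` near `ℓ` and converging to `1` on `(-∞, ℓ)`. -/
def cutoff (ℓ : ℝ) (n : ℕ) (x : ℝ) : ℝ := max 0 (min 1 (n * (ℓ - x) - 1))

lemma continuous_cutoff (n : ℕ) : Continuous (cutoff ℓ n) := by unfold cutoff; fun_prop

lemma tsupport_cutoff_subset (n : ℕ) : tsupport (cutoff ℓ n) ⊆ Iio ℓ := by
  have hpos : (0 : ℝ) < 1 / (n + 1) := by positivity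
  refine (closure_minimal (t := Iic (ℓ - 1 / (n + 1))) (fun x hx => ?_) isClosed_Iic).trans
    (Iic_subset_Iio.2 (sub_lt_self ℓ hpos))
  by_contra hxn
  rw [mem_Iic, not_le] at hxn
  refine hx (max_eq_left (min_le_of_right_le (sub_nonpos.2 ?_)))
  calc (n : ℝ) * (ℓ - x) ≤ n * (1 / (n + 1)) := by gcongr; linarith
    _ ≤ (n + 1) * (1 / (n + 1)) := by gcongr; exact le_add_of_nonneg_right zero_le_one
    _ = 1 := mul_one_div_cancel (by positivity)

lemma abs_mul_cutoff_le (g : ℝ) (n : ℕ) (x : ℝ) : |g * cutoff ℓ n x| ≤ |g| := by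
  rw [abs_mul, abs_of_nonneg (show 0 ≤ cutoff ℓ n x from le_max_left _ _)]
  exact mul_le_of_le_one_right (abs_nonneg _) (max_le zero_le_one (min_le_left _ _))

lemma tendsto_cutoff {x : ℝ} (hx : x < ℓ) : Tendsto (fun n => cutoff ℓ n x) atTop (𝓝 1) := by
  have h : Tendsto (fun n : ℕ => (n : ℝ) * (ℓ - x) - 1) atTop atTop :=
    tendsto_atTop_add_const_right _ _
      (tendsto_natCast_atTop_atTop.atTop_mul_const (sub_pos.2 hx))
  refine tendsto_const_nhds.congr' ((h.eventually_ge_atTop 1).mono fun n hn => ?_)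
  simp only [cutoff, min_eq_left hn, max_eq_right zero_le_one]

lemma tendsto_integral_mul_cutoff {a : ℝ} (ha : a ≤ ℓ) {g : ℝ → ℝ}
    (hg : IntervalIntegrable g volume a ℓ) :
    Tendsto (fun n => ∫ x in a..ℓ, g x * cutoff ℓ n x) atTop (𝓝 (∫ x in a..ℓ, g x)) := by
  refine intervalIntegral.tendsto_integral_filter_of_dominated_convergence (fun x => |g x|)
    (Eventually.of_forall fun n =>
      (hg.mul_continuousOn (continuous_cutoff n).continuousOn).def'.aestronglyMeasurable)
    (Eventually.of_forall fun n => Eventually.of_forall fun x _ => abs_mul_cutoff_le _ n x)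
    hg.abs ?_
  filter_upwards [volume.ae_ne ℓ] with x hxℓ hx
  rw [uIoc_of_le ha] at hx
  simpa only [mul_one] using (tendsto_cutoff (hx.2.lt_of_ne hxℓ)).const_mul (g x)

lemma tendsto_integral_integral_mul_cutoff (hℓ : 0 ≤ ℓ) {t : ℝ} (ht : 0 ≤ t)
    (hf : ContinuousInL1On (Icc 0 t) 0 ℓ f) :
    Tendsto (fun n => ∫ σ in (0 : ℝ)..t, ∫ x in (0 : ℝ)..ℓ, f σ x * cutoff ℓ n x)
      atTop (𝓝 (∫ σ in (0 : ℝ)..t, ∫ x in (0 : ℝ)..ℓ, f σ x)) := by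
  have hmul : ∀ n, ContinuousInL1On (Icc 0 t) 0 ℓ (fun σ x => f σ x * cutoff ℓ n x) := fun n =>
    hf.mul_const hℓ (continuous_cutoff n).continuousOn
  have hmem : ∀ σ ∈ uIoc 0 t, σ ∈ Icc 0 t := fun σ hσ => by
    rw [uIoc_of_le ht] at hσ
    exact Ioc_subset_Icc_self hσ
  refine intervalIntegral.tendsto_integral_filter_of_dominated_convergence
    (fun σ => ∫ x in (0 : ℝ)..ℓ, |f σ x|)
    (Eventually.of_forall fun n => (intervalIntegrable_of_continuousOn_Icc ht
      ((hmul n).continuousOn_integral hℓ)).def'.aestronglyMeasurable)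
    (Eventually.of_forall fun n => Eventually.of_forall fun σ hσ => ?_)
    (intervalIntegrable_of_continuousOn_Icc ht ((hf.abs hℓ).continuousOn_integral hℓ))
    (Eventually.of_forall fun σ hσ =>
      tendsto_integral_mul_cutoff hℓ (hf.intervalIntegrable (hmem σ hσ)))
  exact (intervalIntegral.abs_integral_le_integral_abs hℓ).trans
    (intervalIntegral.integral_mono_on hℓ ((hmul n).intervalIntegrable (hmem σ hσ)).abs
      (hf.intervalIntegrable (hmem σ hσ)).abs fun x _ => abs_mul_cutoff_le _ n x)

/-- The primitive `D t x = ∫₀ˣ r t` satisfies `∂ₜ D = -f`. -/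
lemma WeaklyConserved.integral_primitive_mul (hT : 0 < T) (hℓ : 0 < ℓ)
    (hr : ContinuousInL1On (Icc 0 T) 0 ℓ r) (hf : ContinuousInL1On (Icc 0 T) 0 ℓ f)
    (hw : WeaklyConserved T ℓ r f) (hγ : ContinuousOn γ (Icc 0 ℓ)) {t : ℝ} (ht : t ∈ Icc 0 T) :
    ∫ x in (0 : ℝ)..ℓ, (∫ y in (0 : ℝ)..x, r t y) * γ x
      = -∫ σ in (0 : ℝ)..t, ∫ x in (0 : ℝ)..ℓ, f σ x * γ x := by
  wlog hγc : Continuous γ generalizing γ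
  · set γ' : ℝ → ℝ := IccExtend hℓ.le ((Icc 0 ℓ).domRestrict γ)
    have hγ' : Continuous γ' := (continuousOn_iff_continuous_domRestrict.1 hγ).Icc_extend'
    have hcongr : ∀ g : ℝ → ℝ, ∫ x in (0 : ℝ)..ℓ, g x * γ' x = ∫ x in (0 : ℝ)..ℓ, g x * γ x :=
      fun g => intervalIntegral.integral_congr fun x hx => by
        rw [uIcc_of_le hℓ.le] at hx
        exact congrArg (g x * ·) (IccExtend_of_mem _ _ hx)
    simpa only [hcongr] using this hγ'.continuousOn hγ'
  have hlhs := tendsto_integral_mul_cutoff hℓ.le (intervalIntegrable_of_continuousOn_Icc hℓ.le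
    ((continuousOn_primitive hℓ.le (hr.intervalIntegrable ht)).mul hγ))
  have hrhs := tendsto_integral_integral_mul_cutoff hℓ.le ht.1
    ((hf.mul_const hℓ.le hγ).mono (Icc_subset_Icc_right ht.2))
  refine tendsto_nhds_unique hlhs (hrhs.neg.congr fun n => ?_)
  simp only [Pi.mul_apply, mul_assoc]
  exact (hw.integral_primitive_mul_of_tsupport_subset hT hℓ hr hf (hγc.mul (continuous_cutoff n))
    ((tsupport_mul_subset_right).trans (tsupport_cutoff_subset n)) ht).symm

end WeaklyConserved

/-! ### The energy method -/

section Energy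

variable {T ℓ : ℝ} {r f : ℝ → ℝ → ℝ}

lemma hasDerivWithinAt_integral_diagonal {a b s : ℝ} {G : ℝ × ℝ → ℝ}
    (hG : ContinuousOn G (Icc a b ×ˢ Icc a b)) (hs : s ∈ Icc a b) :
    HasDerivWithinAt (fun t => ∫ σ in s..t, G (σ, t)) (G (s, s)) (Icc a b) s := by
  rw [hasDerivWithinAt_iff_isLittleO, Asymptotics.isLittleO_iff]
  intro ε hε
  obtain ⟨δ, hδ, hGδ⟩ := Metric.continuousWithinAt_iff.1 (hG (s, s) ⟨hs, hs⟩) ε hε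
  filter_upwards [self_mem_nhdsWithin, mem_nhdsWithin_of_mem_nhds (Metric.ball_mem_nhds s hδ)]
    with t ht htδ
  have hmem : ∀ σ ∈ uIcc s t, σ ∈ Icc a b := fun σ hσ => uIcc_subset_Icc hs ht hσ
  have hint : IntervalIntegrable (fun σ => G (σ, t)) volume s t :=
    (hG.comp (f := fun σ => (σ, t)) (by fun_prop)
      fun σ hσ => ⟨hmem σ hσ, ht⟩).intervalIntegrable
  rw [intervalIntegral.integral_same, sub_zero, ← intervalIntegral.integral_const,
    ← intervalIntegral.integral_sub hint intervalIntegrable_const]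
  refine intervalIntegral.norm_integral_le_of_norm_le_const fun σ hσ => ?_
  have hσt : dist σ s ≤ dist t s := by
    rw [Real.dist_eq, Real.dist_eq]
    exact abs_sub_left_of_mem_uIcc (uIoc_subset_uIcc hσ)
  have htδ' := Metric.mem_ball.1 htδ
  exact (hGδ ⟨hmem σ (uIoc_subset_uIcc hσ), ht⟩ (max_lt (hσt.trans_lt htδ') htδ')).le

/-- The energy `∫ D²` of the primitive `D t x = ∫₀ˣ r t`: its growth controls the distance of two
weak solutions with the same data, `r` being their difference. -/
noncomputable def energy (ℓ : ℝ) (r : ℝ → ℝ → ℝ) (t : ℝ) : ℝ :=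
  ∫ x in (0 : ℝ)..ℓ, (∫ y in (0 : ℝ)..x, r t y) ^ 2

lemma WeaklyConserved.energy_zero (hT : 0 < T) (hℓ : 0 < ℓ)
    (hr : ContinuousInL1On (Icc 0 T) 0 ℓ r) (hf : ContinuousInL1On (Icc 0 T) 0 ℓ f)
    (hw : WeaklyConserved T ℓ r f) : energy ℓ r 0 = 0 := by
  have h0 : (0 : ℝ) ∈ Icc 0 T := ⟨le_rfl, hT.le⟩
  have := hw.integral_primitive_mul hT hℓ hr hf
    (continuousOn_primitive hℓ.le (hr.intervalIntegrable h0)) h0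
  rw [intervalIntegral.integral_same, neg_zero] at this
  simpa only [energy, sq] using this

lemma WeaklyConserved.integral_primitive_sub_mul (hT : 0 < T) (hℓ : 0 < ℓ)
    (hr : ContinuousInL1On (Icc 0 T) 0 ℓ r) (hf : ContinuousInL1On (Icc 0 T) 0 ℓ f)
    (hw : WeaklyConserved T ℓ r f) {γ : ℝ → ℝ} (hγ : ContinuousOn γ (Icc 0 ℓ)) {s t : ℝ}
    (hs : s ∈ Icc 0 T) (ht : t ∈ Icc 0 T) :
    ∫ x in (0 : ℝ)..ℓ, ((∫ y in (0 : ℝ)..x, r t y) - ∫ y in (0 : ℝ)..x, r s y) * γ x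
      = -∫ σ in s..t, ∫ x in (0 : ℝ)..ℓ, f σ x * γ x := by
  have hmul : ∀ τ ∈ Icc 0 T,
      IntervalIntegrable (fun x => (∫ y in (0 : ℝ)..x, r τ y) * γ x) volume 0 ℓ := fun τ hτ =>
    intervalIntegrable_of_continuousOn_Icc hℓ.le
      ((continuousOn_primitive hℓ.le (hr.intervalIntegrable hτ)).mul hγ)
  have hflux : ∀ τ ∈ Icc 0 T,
      IntervalIntegrable (fun σ => ∫ x in (0 : ℝ)..ℓ, f σ x * γ x) volume 0 τ := fun τ hτ =>
    (intervalIntegrable_of_continuousOn_Icc hT.le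
      ((hf.mul_const hℓ.le hγ).continuousOn_integral hℓ.le)).mono_set
      (uIcc_subset_uIcc_left (Icc_subset_uIcc hτ))
  simp only [sub_mul]
  rw [intervalIntegral.integral_sub (hmul t ht) (hmul s hs),
    hw.integral_primitive_mul hT hℓ hr hf hγ ht, hw.integral_primitive_mul hT hℓ hr hf hγ hs,
    neg_sub_neg, ← intervalIntegral.integral_interval_sub_left (hflux t ht) (hflux s hs), neg_sub]

lemma WeaklyConserved.energy_eq_sub_integral (hT : 0 < T) (hℓ : 0 < ℓ)
    (hr : ContinuousInL1On (Icc 0 T) 0 ℓ r) (hf : ContinuousInL1On (Icc 0 T) 0 ℓ f)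
    (hw : WeaklyConserved T ℓ r f) {s t : ℝ} (hs : s ∈ Icc 0 T) (ht : t ∈ Icc 0 T) :
    energy ℓ r t = energy ℓ r s - ∫ σ in s..t, ∫ x in (0 : ℝ)..ℓ,
      f σ x * ((∫ y in (0 : ℝ)..x, r s y) + ∫ y in (0 : ℝ)..x, r t y) := by
  have hD : ∀ τ ∈ Icc 0 T, ContinuousOn (fun x => ∫ y in (0 : ℝ)..x, r τ y) (Icc 0 ℓ) :=
    fun τ hτ => continuousOn_primitive hℓ.le (hr.intervalIntegrable hτ)
  have hD2 : ∀ τ ∈ Icc 0 T,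
      IntervalIntegrable (fun x => (∫ y in (0 : ℝ)..x, r τ y) ^ 2) volume 0 ℓ := fun τ hτ =>
    intervalIntegrable_of_continuousOn_Icc hℓ.le ((hD τ hτ).pow 2)
  have hmain := hw.integral_primitive_sub_mul hT hℓ hr hf
    (γ := fun x => (∫ y in (0 : ℝ)..x, r s y) + ∫ y in (0 : ℝ)..x, r t y)
    ((hD s hs).add (hD t ht)) hs ht
  rw [sub_eq_add_neg, ← hmain, ← sub_eq_iff_eq_add', energy, energy,
    ← intervalIntegral.integral_sub (hD2 t ht) (hD2 s hs)]
  exact intervalIntegral.integral_congr fun x _ => by ring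

lemma WeaklyConserved.hasDerivWithinAt_energy (hT : 0 < T) (hℓ : 0 < ℓ)
    (hr : ContinuousInL1On (Icc 0 T) 0 ℓ r) (hf : ContinuousInL1On (Icc 0 T) 0 ℓ f)
    (hw : WeaklyConserved T ℓ r f) {s : ℝ} (hs : s ∈ Icc 0 T) :
    HasDerivWithinAt (energy ℓ r)
      (-2 * ∫ x in (0 : ℝ)..ℓ, f s x * ∫ y in (0 : ℝ)..x, r s y) (Icc 0 T) s := by
  have hfluxcont : ContinuousOn (fun z : ℝ × ℝ => ∫ x in (0 : ℝ)..ℓ,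
      f z.1 x * ((∫ y in (0 : ℝ)..x, r s y) + ∫ y in (0 : ℝ)..x, r z.2 y))
      (Icc 0 T ×ˢ Icc 0 T) := by
    have hD := hr.continuousOn_primitive hℓ.le
    have hDD : ContinuousOn (fun w : (ℝ × ℝ) × ℝ =>
        (∫ y in (0 : ℝ)..w.2, r s y) + ∫ y in (0 : ℝ)..w.2, r w.1.2 y)
        ((Icc 0 T ×ˢ Icc 0 T) ×ˢ Icc 0 ℓ) :=
      (hD.comp (f := fun w : (ℝ × ℝ) × ℝ => (s, w.2)) (by fun_prop) fun w hw => ⟨hs, hw.2⟩).add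
        (hD.comp (f := fun w : (ℝ × ℝ) × ℝ => (w.1.2, w.2)) (by fun_prop)
          fun w hw => ⟨hw.1.2, hw.2⟩)
    simpa only [mul_comm] using ((hf.comp (g := Prod.fst) (by fun_prop)
      fun z hz => hz.1).continuousOn_mul hℓ.le hDD).continuousOn_integral hℓ.le
  have hderiv := (hasDerivWithinAt_integral_diagonal hfluxcont hs).const_sub (energy ℓ r s)
  have henergy := fun t ht => hw.energy_eq_sub_integral hT hℓ hr hf hs (t := t) ht
  refine (hderiv.congr henergy (henergy s hs)).congr_deriv ?_
  simp only [← two_mul, mul_left_comm (f s _) 2]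
  rw [intervalIntegral.integral_const_mul, neg_mul]

lemma nonpos_of_hasDerivWithinAt_le_mul {E E' : ℝ → ℝ} {K : ℝ} (h0 : E 0 ≤ 0)
    (hE : ∀ t ∈ Icc 0 T, HasDerivWithinAt E (E' t) (Icc 0 T) t)
    (hle : ∀ t ∈ Icc 0 T, E' t ≤ K * E t) {t : ℝ} (ht : t ∈ Icc 0 T) : E t ≤ 0 := by
  rw [← gronwallBound_ε0_δ0 K (t - 0)]
  refine le_gronwallBound_of_liminf_deriv_right_le (fun t ht => (hE t ht).continuousWithinAt)
    (fun t ht R hR => ?_) h0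
    (fun t ht => by simpa only [add_zero] using hle t (Ico_subset_Icc_self ht)) t ht
  simpa only [slope_def_field, div_eq_inv_mul] using ((hE t (Ico_subset_Icc_self
    ht)).mono_of_mem_nhdsWithin (Icc_mem_nhdsGE_of_mem ht)).liminf_right_slope_le hR

lemma ae_eq_zero_of_primitive_eq_zero {a b : ℝ} {g : ℝ → ℝ} (hg : IntervalIntegrable g volume a b)
    (h : ∀ x ∈ Icc a b, ∫ y in a..x, g y = 0) :
    ∀ᵐ x ∂(volume.restrict (Icc a b)), g x = 0 := by
  rw [← restrict_Ioo_eq_restrict_Icc, ae_restrict_iff' measurableSet_Ioo]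
  filter_upwards [hg.ae_hasDerivAt_integral] with x hx hx'
  have hderiv := hx (Icc_subset_uIcc (Ioo_subset_Icc_self hx')) a left_mem_uIcc
  have hzero : (fun x => ∫ y in a..x, g y) =ᶠ[𝓝 x] fun _ => 0 := by
    filter_upwards [Ioo_mem_nhds hx'.1 hx'.2] with y hy using h y (Ioo_subset_Icc_self hy)
  exact hderiv.unique ((hasDerivAt_const x 0).congr_of_eventuallyEq hzero)

lemma WeaklyConserved.ae_eq_zero (hT : 0 < T) (hℓ : 0 < ℓ)
    (hr : ContinuousInL1On (Icc 0 T) 0 ℓ r) (hf : ContinuousInL1On (Icc 0 T) 0 ℓ f)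
    (hw : WeaklyConserved T ℓ r f) {K : ℝ}
    (hK : ∀ t ∈ Icc 0 T,
      -2 * (∫ x in (0 : ℝ)..ℓ, f t x * ∫ y in (0 : ℝ)..x, r t y) ≤ K * energy ℓ r t)
    {t : ℝ} (ht : t ∈ Icc 0 T) : ∀ᵐ x ∂(volume.restrict (Icc (0 : ℝ) ℓ)), r t x = 0 := by
  have henergy : energy ℓ r t ≤ 0 :=
    nonpos_of_hasDerivWithinAt_le_mul (hw.energy_zero hT hℓ hr hf).le
      (fun t ht => hw.hasDerivWithinAt_energy hT hℓ hr hf ht) hK ht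
  refine ae_eq_zero_of_primitive_eq_zero (hr.intervalIntegrable ht) fun x hx => ?_
  by_contra hne
  exact henergy.not_gt (intervalIntegral.integral_pos hℓ
    ((continuousOn_primitive hℓ.le (hr.intervalIntegrable ht)).pow 2) (fun _ _ => sq_nonneg _)
    ⟨x, hx, sq_pos_of_ne_zero hne⟩)

end Energy

section Dissipation

variable {a b : ℝ}

/-- The right-hand side is `-∫ ∂ₓ(c D²) + ∫ (∂ₓ c) D²`, with `D` the primitive of `g`. -/
lemma neg_two_mul_integral_flux_mul_primitive_le (hab : a ≤ b) {g c : ℝ → ℝ}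
    (hg : IntervalIntegrable g volume a b) {K : ℝ≥0} (hc : LipschitzOnWith K c (Icc a b)) :
    -2 * (∫ x in a..b, c x * g x * ∫ y in a..x, g y)
      ≤ K * (∫ x in a..b, (∫ y in a..x, g y) ^ 2) - c b * (∫ y in a..b, g y) ^ 2 := by
  set D : ℝ → ℝ := fun x => ∫ y in a..x, g y
  have hDac : AbsolutelyContinuousOnInterval D a b :=
    hg.absolutelyContinuousOnInterval_intervalIntegral left_mem_uIcc
  have hcac : AbsolutelyContinuousOnInterval c a b :=
    LipschitzOnWith.absolutelyContinuousOnInterval (by rwa [uIcc_of_le hab])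
  have hD2 : AbsolutelyContinuousOnInterval (D * D) a b := hDac.mul hDac
  have hparts := hcac.integral_mul_deriv_eq_deriv_mul hD2
  have hflux : ∫ x in a..b, c x * deriv (D * D) x = 2 * ∫ x in a..b, c x * g x * D x := by
    rw [← intervalIntegral.integral_const_mul]
    refine intervalIntegral.integral_congr_ae ?_
    filter_upwards [hg.ae_hasDerivAt_integral] with x hx hx'
    have hDx := hx (uIoc_subset_uIcc hx') a left_mem_uIcc
    rw [(hDx.mul hDx).deriv]
    ring
  have hcderiv : ∫ x in a..b, deriv c x * (D * D) x ≤ K * ∫ x in a..b, D x ^ 2 := by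
    rw [← intervalIntegral.integral_const_mul]
    refine intervalIntegral.integral_mono_on_of_le_Ioo hab
      (hcac.intervalIntegrable_deriv.mul_continuousOn hD2.continuousOn)
      (intervalIntegrable_of_continuousOn_Icc hab
        (((continuousOn_primitive hab hg).pow 2).const_mul _)) fun x hx => ?_
    rw [Pi.mul_apply, ← sq]
    gcongr
    exact (le_abs_self _).trans (norm_deriv_le_of_lipschitzOn (Icc_mem_nhds hx.1 hx.2) hc)
  have hDa : D a = 0 := intervalIntegral.integral_same
  simp only [Pi.mul_apply, ← sq, hDa] at hparts hflux hcderiv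
  linarith

lemma neg_two_mul_integral_mul_le (hab : a ≤ b) {h D : ℝ → ℝ}
    (hh : IntervalIntegrable h volume a b) (hD : ContinuousOn D (Icc a b)) {A m ε : ℝ}
    (hε : 0 < ε) (hbound : ∀ᵐ x ∂(volume.restrict (Icc a b)), |h x| ≤ A * |m|) :
    -2 * (∫ x in a..b, h x * D x)
      ≤ ε * (b - a) * m ^ 2 + ε⁻¹ * A ^ 2 * ∫ x in a..b, D x ^ 2 := by
  have hD2 : IntervalIntegrable (fun x => ε⁻¹ * A ^ 2 * D x ^ 2) volume a b :=
    intervalIntegrable_of_continuousOn_Icc hab ((hD.pow 2).const_mul _)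
  have hint : ∫ x in a..b, -2 * (h x * D x)
      ≤ ∫ x in a..b, (ε * m ^ 2 + ε⁻¹ * A ^ 2 * D x ^ 2) := by
    refine intervalIntegral.integral_mono_ae_restrict hab
      ((hh.mul_continuousOn (by rwa [uIcc_of_le hab])).const_mul _)
      (intervalIntegrable_const.add hD2) ?_
    filter_upwards [hbound] with x hx
    calc -2 * (h x * D x) ≤ 2 * (|h x| * |D x|) := by
          rw [← abs_mul]
          linarith [neg_abs_le (h x * D x)]
      _ ≤ 2 * ((A * |m|) * |D x|) := by gcongr
      _ = 2 * |m| * (A * |D x|) := by ring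
      _ ≤ ε * |m| ^ 2 + ε⁻¹ * (A * |D x|) ^ 2 := two_mul_le_add_mul_sq hε
      _ = ε * m ^ 2 + ε⁻¹ * A ^ 2 * D x ^ 2 := by rw [mul_pow, sq_abs, sq_abs, mul_assoc]
  rw [intervalIntegral.integral_const_mul, intervalIntegral.integral_add intervalIntegrable_const
    hD2, intervalIntegral.integral_const, intervalIntegral.integral_const_mul, smul_eq_mul] at hint
  linarith

/-- The boundary term `c₁ b D(b)²` lost at the outlet absorbs the influence of the speeds on each
other, which is only felt through the total mass `D(b)`. -/
lemma neg_two_mul_integral_flux_sub_mul_primitive_le (hab : a < b) {r₁ r₂ c₁ c₂ : ℝ → ℝ}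
    (hr₁ : IntervalIntegrable r₁ volume a b) (hr₂ : IntervalIntegrable r₂ volume a b) {K : ℝ≥0}
    (hc₁ : LipschitzOnWith K c₁ (Icc a b)) (hc₂ : ContinuousOn c₂ (Icc a b)) {cmin : ℝ}
    (hcmin : 0 < cmin) (hmin : cmin ≤ c₁ b) {M : ℝ}
    (hM : ∀ᵐ x ∂(volume.restrict (Icc a b)), |r₂ x| ≤ M) {K' : ℝ}
    (hdiff : ∀ x ∈ Icc a b, |c₁ x - c₂ x| ≤ K' * |∫ y in a..b, (r₁ y - r₂ y)|) :
    -2 * (∫ x in a..b, (c₁ x * r₁ x - c₂ x * r₂ x) * ∫ y in a..x, (r₁ y - r₂ y))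
      ≤ (K + (cmin / (b - a))⁻¹ * (K' * M) ^ 2)
        * ∫ x in a..b, (∫ y in a..x, (r₁ y - r₂ y)) ^ 2 := by
  set D : ℝ → ℝ := fun x => ∫ y in a..x, (r₁ y - r₂ y)
  have hD : ContinuousOn D (Icc a b) := continuousOn_primitive hab.le (hr₁.sub hr₂)
  have hD' : ContinuousOn D (uIcc a b) := by rwa [uIcc_of_le hab.le]
  have hcr : IntervalIntegrable (fun x => c₁ x * (r₁ x - r₂ x)) volume a b :=
    intervalIntegrable_continuousOn_mul hab.le hc₁.continuousOn (hr₁.sub hr₂)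
  have hdcr : IntervalIntegrable (fun x => (c₁ x - c₂ x) * r₂ x) volume a b :=
    intervalIntegrable_continuousOn_mul hab.le (hc₁.continuousOn.sub hc₂) hr₂
  have hsplit : ∫ x in a..b, (c₁ x * r₁ x - c₂ x * r₂ x) * D x
      = (∫ x in a..b, c₁ x * (r₁ x - r₂ x) * D x) + ∫ x in a..b, (c₁ x - c₂ x) * r₂ x * D x := by
    rw [← intervalIntegral.integral_add (hcr.mul_continuousOn hD') (hdcr.mul_continuousOn hD')]
    exact intervalIntegral.integral_congr fun x _ => by ring
  have htransport : -2 * (∫ x in a..b, c₁ x * (r₁ x - r₂ x) * D x)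
      ≤ K * (∫ x in a..b, D x ^ 2) - c₁ b * D b ^ 2 :=
    neg_two_mul_integral_flux_mul_primitive_le hab.le (hr₁.sub hr₂) hc₁
  have hcoupling : -2 * (∫ x in a..b, (c₁ x - c₂ x) * r₂ x * D x)
      ≤ cmin / (b - a) * (b - a) * D b ^ 2
        + (cmin / (b - a))⁻¹ * (K' * M) ^ 2 * ∫ x in a..b, D x ^ 2 := by
    refine neg_two_mul_integral_mul_le hab.le hdcr hD (div_pos hcmin (sub_pos.2 hab)) ?_
    filter_upwards [hM, ae_restrict_mem measurableSet_Icc] with x hx hx'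
    calc |(c₁ x - c₂ x) * r₂ x| ≤ K' * |D b| * M := by
          rw [abs_mul]
          gcongr
          · exact (abs_nonneg _).trans (hdiff x hx')
          · exact hdiff x hx'
      _ = K' * M * |D b| := mul_right_comm _ _ _
  rw [div_mul_cancel₀ _ (sub_pos.2 hab).ne'] at hcoupling
  have hboundary : cmin * D b ^ 2 ≤ c₁ b * D b ^ 2 := by gcongr
  rw [hsplit, add_mul]
  linarith

end Dissipation

/-! ### Uniqueness -/

section Uniqueness

variable {T ℓ : ℝ}

/-- The weak form of `SatisfiesWeakly` for representatives. -/
def WeakForm (T ℓ : ℝ) (c : ℝ → ℝ → ℝ) (r₀ u : ℝ → ℝ) (r : ℝ → ℝ → ℝ) : Prop :=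
  ∀ φ : ℝ × ℝ → ℝ, IsTestFunction T ℓ φ →
    (∫ t in (0 : ℝ)..T, ∫ x in (0 : ℝ)..ℓ,
        r t x * (fderiv ℝ φ (t, x) (1, 0) + c t x * fderiv ℝ φ (t, x) (0, 1)))
      + (∫ x in (0 : ℝ)..ℓ, r₀ x * φ (0, x))
      + (∫ t in (0 : ℝ)..T, u t * φ (t, 0)) = 0

variable {r₁ r₂ c₁ c₂ : ℝ → ℝ → ℝ} {r₀ u : ℝ → ℝ}

lemma WeakForm.weaklyConserved_sub (hT : 0 < T) (hℓ : 0 < ℓ)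
    (hr₁ : ContinuousInL1On (Icc 0 T) 0 ℓ r₁) (hr₂ : ContinuousInL1On (Icc 0 T) 0 ℓ r₂)
    (hc₁ : ContinuousOn (fun z : ℝ × ℝ => c₁ z.1 z.2) (Icc 0 T ×ˢ Icc 0 ℓ))
    (hc₂ : ContinuousOn (fun z : ℝ × ℝ => c₂ z.1 z.2) (Icc 0 T ×ˢ Icc 0 ℓ))
    (h₁ : WeakForm T ℓ c₁ r₀ u r₁) (h₂ : WeakForm T ℓ c₂ r₀ u r₂) :
    WeaklyConserved T ℓ (fun t x => r₁ t x - r₂ t x)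
      (fun t x => c₁ t x * r₁ t x - c₂ t x * r₂ t x) := by
  intro φ hφ
  have hderiv : ∀ v, Continuous fun z => fderiv ℝ φ z v := fun v =>
    (hφ.1.continuous_fderiv one_ne_zero).clm_apply continuous_const
  have hint : ∀ {c r : ℝ → ℝ → ℝ},
      ContinuousOn (fun z : ℝ × ℝ => c z.1 z.2) (Icc 0 T ×ˢ Icc 0 ℓ) →
      ContinuousInL1On (Icc 0 T) 0 ℓ r → ContinuousInL1On (Icc 0 T) 0 ℓ (fun t x =>
        r t x * (fderiv ℝ φ (t, x) (1, 0) + c t x * fderiv ℝ φ (t, x) (0, 1))) := fun hc hr => by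
    simpa only [mul_comm] using hr.continuousOn_mul hℓ.le
      ((hderiv (1, 0)).continuousOn.add (hc.mul (hderiv (0, 1)).continuousOn))
  have hr₁' := hint hc₁ hr₁
  have hr₂' := hint hc₂ hr₂
  refine Eq.trans ?_ (sub_eq_zero.2 ((h₁ φ hφ).trans (h₂ φ hφ).symm))
  rw [add_sub_add_right_eq_sub, add_sub_add_right_eq_sub, ← intervalIntegral.integral_sub
    (intervalIntegrable_of_continuousOn_Icc hT.le (hr₁'.continuousOn_integral hℓ.le))
    (intervalIntegrable_of_continuousOn_Icc hT.le (hr₂'.continuousOn_integral hℓ.le))]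
  refine intervalIntegral.integral_congr fun t ht => ?_
  rw [uIcc_of_le hT.le] at ht
  simp only
  rw [← intervalIntegral.integral_sub (hr₁'.intervalIntegrable ht) (hr₂'.intervalIntegrable ht)]
  exact intervalIntegral.integral_congr fun x _ => by ring

theorem WeakForm.ae_eq (hT : 0 < T) (hℓ : 0 < ℓ)
    (hr₁ : ContinuousInL1On (Icc 0 T) 0 ℓ r₁) (hr₂ : ContinuousInL1On (Icc 0 T) 0 ℓ r₂)
    (hc₁ : ContinuousOn (fun z : ℝ × ℝ => c₁ z.1 z.2) (Icc 0 T ×ˢ Icc 0 ℓ))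
    (hc₂ : ContinuousOn (fun z : ℝ × ℝ => c₂ z.1 z.2) (Icc 0 T ×ˢ Icc 0 ℓ))
    (h₁ : WeakForm T ℓ c₁ r₀ u r₁) (h₂ : WeakForm T ℓ c₂ r₀ u r₂)
    {K : ℝ≥0} (hlip : ∀ t ∈ Icc 0 T, LipschitzOnWith K (c₁ t) (Icc 0 ℓ))
    {cmin : ℝ} (hcmin : 0 < cmin) (hmin : ∀ t ∈ Icc 0 T, cmin ≤ c₁ t ℓ)
    {M : ℝ} (hM : ∀ t ∈ Icc 0 T, ∀ᵐ x ∂(volume.restrict (Icc (0 : ℝ) ℓ)), |r₂ t x| ≤ M)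
    {K' : ℝ} (hdiff : ∀ t ∈ Icc 0 T, ∀ x ∈ Icc 0 ℓ,
      |c₁ t x - c₂ t x| ≤ K' * |∫ y in (0 : ℝ)..ℓ, (r₁ t y - r₂ t y)|)
    {t : ℝ} (ht : t ∈ Icc 0 T) :
    ∀ᵐ x ∂(volume.restrict (Icc (0 : ℝ) ℓ)), r₁ t x = r₂ t x := by
  have hzero := (WeakForm.weaklyConserved_sub hT hℓ hr₁ hr₂ hc₁ hc₂ h₁ h₂).ae_eq_zero hT hℓ
    (hr₁.sub hℓ.le hr₂) ((hr₁.continuousOn_mul hℓ.le hc₁).sub hℓ.le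
      (hr₂.continuousOn_mul hℓ.le hc₂))
    (fun t ht => neg_two_mul_integral_flux_sub_mul_primitive_le hℓ (hr₁.intervalIntegrable ht)
      (hr₂.intervalIntegrable ht) (hlip t ht) (continuousOn_section hc₂ ht) hcmin (hmin t ht)
      (hM t ht) (hdiff t ht)) ht
  filter_upwards [hzero] with x hx using sub_eq_zero.1 hx

end Uniqueness

/-! ### Increasing bi-Lipschitz changes of variables -/

/-- A measurable function that is bounded by `M` everywhere: the data of the linear problem are
represented by such functions so that they can be composed with characteristics. -/
structure BoundedMeasurable (M : ℝ) (g : ℝ → ℝ) : Prop where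
  measurable : Measurable g
  abs_le : ∀ x, |g x| ≤ M

namespace BoundedMeasurable

variable {M a b : ℝ} {g : ℝ → ℝ}

lemma bound_nonneg (hg : BoundedMeasurable M g) : 0 ≤ M := (abs_nonneg _).trans (hg.abs_le 0)

lemma memLp (hg : BoundedMeasurable M g) {p : ℝ≥0∞} {μ : Measure ℝ} [IsFiniteMeasure μ] :
    MemLp g p μ :=
  .of_bound hg.measurable.aestronglyMeasurable M (Eventually.of_forall hg.abs_le)

lemma intervalIntegrable (hg : BoundedMeasurable M g) (a b : ℝ) :
    IntervalIntegrable g volume a b :=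
  (intervalIntegrable_const (c := M)).mono_fun' hg.measurable.aestronglyMeasurable
    (Eventually.of_forall hg.abs_le)

lemma abs_integral_le (hg : BoundedMeasurable M g) (a b : ℝ) :
    |∫ x in a..b, g x| ≤ M * |b - a| :=
  intervalIntegral.norm_integral_le_of_norm_le_const (f := g) fun x _ => hg.abs_le x

end BoundedMeasurable

/-- `Z` is an increasing bijection of the line with inverse `W`, both `K`-Lipschitz. -/
structure IncreasingBiLipschitz (K : ℝ≥0) (Z W : ℝ → ℝ) : Prop where
  strictMono : StrictMono Z
  lipschitz : LipschitzWith K Z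
  lipschitz_inv : LipschitzWith K W
  left_inv : ∀ x, W (Z x) = x
  right_inv : ∀ x, Z (W x) = x

namespace IncreasingBiLipschitz

variable {K : ℝ≥0} {Z W g : ℝ → ℝ} {M x : ℝ}

lemma symm (h : IncreasingBiLipschitz K Z W) : IncreasingBiLipschitz K W Z where
  strictMono x y hxy := by
    rwa [← h.right_inv x, ← h.right_inv y, h.strictMono.lt_iff_lt] at hxy
  lipschitz := h.lipschitz_inv
  lipschitz_inv := h.lipschitz
  left_inv := h.right_inv
  right_inv := h.left_inv

lemma ae_comp (h : IncreasingBiLipschitz K Z W) {P : ℝ → Prop} (hP : ∀ᵐ x, P x) :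
    ∀ᵐ x, P (Z x) := by
  have hnull : volume (W '' {x | ¬P x}) = 0 := by
    have hle := h.lipschitz_inv.hausdorffMeasure_image_le zero_le_one {x | ¬P x}
    rwa [hausdorffMeasure_real, ae_iff.1 hP, mul_zero, nonpos_iff_eq_zero] at hle
  exact measure_mono_null (t := W '' {x | ¬P x}) (fun x hx => ⟨Z x, hx, h.left_inv x⟩) hnull

lemma deriv_nonneg (h : IncreasingBiLipschitz K Z W) (x : ℝ) : 0 ≤ deriv Z x :=
  h.strictMono.monotone.deriv_nonneg

lemma abs_deriv_le (h : IncreasingBiLipschitz K Z W) (x : ℝ) : |deriv Z x| ≤ K :=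
  norm_deriv_le_of_lipschitz h.lipschitz

lemma one_le_mul_deriv (h : IncreasingBiLipschitz K Z W) (hx : DifferentiableAt ℝ Z x) :
    1 ≤ K * deriv Z x := by
  have hmono : Monotone fun y => K * Z y - y := fun y y' hyy' => by
    have hW := h.lipschitz_inv.dist_le_mul (Z y') (Z y)
    rw [h.left_inv, h.left_inv, Real.dist_eq, Real.dist_eq, abs_of_nonneg (sub_nonneg.2 hyy'),
      abs_of_nonneg (sub_nonneg.2 (h.strictMono.monotone hyy'))] at hW
    linarith
  have hderiv := ((hx.hasDerivAt.const_mul (K : ℝ)).sub (hasDerivAt_id x)).deriv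
  exact sub_nonneg.1 (hderiv ▸ hmono.deriv_nonneg (x := x))

lemma abs_deriv_sub_one_le (h : IncreasingBiLipschitz K Z W) (hx : DifferentiableAt ℝ Z x) :
    |deriv Z x - 1| ≤ K - 1 := by
  have hle := (le_abs_self _).trans (h.abs_deriv_le x)
  refine abs_le.2 ⟨?_, by linarith⟩
  -- AM-GM: `2 ≤ K + Z'` because `1 ≤ K * Z'`
  nlinarith [h.one_le_mul_deriv hx, sq_nonneg ((K : ℝ) - deriv Z x), h.deriv_nonneg x, K.coe_nonneg]

lemma image_Ioc (h : IncreasingBiLipschitz K Z W) (a b : ℝ) :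
    Z '' Ioc a b = Ioc (Z a) (Z b) := by
  refine Subset.antisymm (image_subset_iff.2 fun x hx =>
    ⟨h.strictMono hx.1, h.strictMono.monotone hx.2⟩) fun y hy => ⟨W y, ⟨?_, ?_⟩, h.right_inv y⟩
  · exact h.left_inv a ▸ h.symm.strictMono hy.1
  · exact h.left_inv b ▸ h.symm.strictMono.monotone hy.2

lemma inter_differentiableAt_ae_eq (h : IncreasingBiLipschitz K Z W) (s : Set ℝ) :
    (s ∩ {x | DifferentiableAt ℝ Z x} : Set ℝ) =ᵐ[volume] s := by
  filter_upwards [h.lipschitz.ae_differentiableAt_real] with x hx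
  exact propext (and_iff_left hx)

lemma image_inter_differentiableAt_ae_eq (h : IncreasingBiLipschitz K Z W) (s : Set ℝ) :
    Z '' (s ∩ {x | DifferentiableAt ℝ Z x}) =ᵐ[volume] Z '' s := by
  filter_upwards [h.symm.ae_comp h.lipschitz.ae_differentiableAt_real] with y hy
  refine propext ⟨fun ⟨x, hx, hxy⟩ => ⟨x, hx.1, hxy⟩, fun ⟨x, hx, hxy⟩ => ⟨x, ⟨hx, ?_⟩, hxy⟩⟩
  rwa [← hxy, h.left_inv] at hy

lemma integral_comp_mul_deriv (h : IncreasingBiLipschitz K Z W) (g : ℝ → ℝ) (a b : ℝ) :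
    ∫ x in a..b, g (Z x) * deriv Z x = ∫ y in Z a..Z b, g y := by
  wlog hab : a ≤ b generalizing a b
  · rw [intervalIntegral.integral_symm, this b a (not_le.1 hab).le,
      intervalIntegral.integral_symm, neg_neg]
  rw [intervalIntegral.integral_of_le hab,
    intervalIntegral.integral_of_le (h.strictMono.monotone hab), ← h.image_Ioc,
    ← setIntegral_congr_set (h.inter_differentiableAt_ae_eq _),
    ← setIntegral_congr_set (h.image_inter_differentiableAt_ae_eq _),
    integral_image_eq_integral_deriv_smul_of_monotoneOn
      (measurableSet_Ioc.inter (measurableSet_of_differentiableAt ℝ Z))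
      (fun x hx => hx.2.hasDerivAt.hasDerivWithinAt) (h.strictMono.monotone.monotoneOn _)]
  simp_rw [smul_eq_mul, mul_comm]

lemma intervalIntegrable_comp_mul_deriv (h : IncreasingBiLipschitz K Z W) {a b : ℝ} (hab : a ≤ b)
    (hg : IntervalIntegrable g volume (Z a) (Z b)) :
    IntervalIntegrable (fun x => g (Z x) * deriv Z x) volume a b := by
  rw [intervalIntegrable_iff_integrableOn_Ioc_of_le (h.strictMono.monotone hab), ← h.image_Ioc,
    ← integrableOn_congr_set_ae (h.image_inter_differentiableAt_ae_eq _),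
    integrableOn_image_iff_integrableOn_deriv_smul_of_monotoneOn
      (measurableSet_Ioc.inter (measurableSet_of_differentiableAt ℝ Z))
      (fun x hx => hx.2.hasDerivAt.hasDerivWithinAt) (h.strictMono.monotone.monotoneOn _),
    integrableOn_congr_set_ae (h.inter_differentiableAt_ae_eq _)] at hg
  rw [intervalIntegrable_iff_integrableOn_Ioc_of_le hab]
  simpa only [smul_eq_mul, mul_comm] using hg

lemma boundedMeasurable_comp_mul_deriv (h : IncreasingBiLipschitz K Z W)
    (hg : BoundedMeasurable M g) : BoundedMeasurable (M * K) fun x => g (Z x) * deriv Z x where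
  measurable := (hg.measurable.comp h.lipschitz.continuous.measurable).mul (measurable_deriv Z)
  abs_le x := by
    rw [abs_mul]
    exact mul_le_mul (hg.abs_le _) (h.abs_deriv_le x) (abs_nonneg _) hg.bound_nonneg

end IncreasingBiLipschitz

section Pullback

variable {ι : Type*} {F : Filter ι} {a b : ℝ} {K : ι → ℝ≥0} {Z W : ι → ℝ → ℝ} {η : ι → ℝ}
  {f : ℝ → ℝ}

lemma exists_uniformContinuous_integral_abs_sub_le (hab : a ≤ b)
    (hf : IntervalIntegrable f volume a b) {ε : ℝ} (hε : 0 < ε) :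
    ∃ g : ℝ → ℝ, UniformContinuous g ∧ (∃ H, ∀ x, |g x| ≤ H) ∧ ∫ x in a..b, |f x - g x| ≤ ε := by
  rw [intervalIntegrable_iff_integrableOn_Ioc_of_le hab] at hf
  obtain ⟨g, hgc, hfg, hg, -⟩ := hf.exists_hasCompactSupport_integral_sub_le hε
  exact ⟨g, hgc.uniformContinuous_of_continuous hg, hg.bounded_above_of_compact_support hgc,
    (intervalIntegral.integral_of_le hab).trans_le hfg⟩

lemma eventually_ae_abs_comp_mul_deriv_sub_le
    (h : ∀ i, IncreasingBiLipschitz (K i) (Z i) (W i)) (hK : Tendsto K F (𝓝 1))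
    (hη : Tendsto η F (𝓝 0)) (hZ : ∀ i y, |Z i y - y| ≤ η i) (hf : UniformContinuous f)
    {H : ℝ} (hH : ∀ x, |f x| ≤ H) {ε : ℝ} (hε : 0 < ε) :
    ∀ᶠ i in F, ∀ᵐ y, |f (Z i y) * deriv (Z i) y - f y| ≤ ε := by
  obtain ⟨δ, hδ, hfδ⟩ := Metric.uniformContinuous_iff.1 hf (ε / 4) (by positivity)
  have hK' : Tendsto (fun i => (K i : ℝ)) F (𝓝 1) := by
    simpa only [NNReal.coe_one] using NNReal.tendsto_coe.2 hK
  have hlim : Tendsto (fun i => H * (K i - 1)) F (𝓝 0) := by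
    simpa only [sub_self, mul_zero] using (hK'.sub_const 1).const_mul H
  filter_upwards [hη.eventually_lt_const hδ, hK'.eventually_le_const one_lt_two,
    hlim.eventually_le_const (half_pos hε)] with i hηi hKi hHi
  filter_upwards [(h i).lipschitz.ae_differentiableAt_real] with y hy
  have hf_sub : |f (Z i y) - f y| ≤ ε / 4 := (hfδ ((hZ i y).trans_lt hηi)).le
  calc |f (Z i y) * deriv (Z i) y - f y|
      = |(f (Z i y) - f y) * deriv (Z i) y + f y * (deriv (Z i) y - 1)| := by ring_nf
    _ ≤ |f (Z i y) - f y| * |deriv (Z i) y| + |f y| * |deriv (Z i) y - 1| := by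
        rw [← abs_mul, ← abs_mul]
        exact abs_add_le _ _
    _ ≤ ε / 4 * 2 + H * (K i - 1) :=
        add_le_add (mul_le_mul hf_sub (((h i).abs_deriv_le y).trans hKi) (abs_nonneg _)
          (by positivity)) (mul_le_mul (hH y) ((h i).abs_deriv_sub_one_le hy) (abs_nonneg _)
          ((abs_nonneg _).trans (hH y)))
    _ ≤ ε := by linarith

lemma integral_abs_comp_mul_deriv_sub_le {K : ℝ≥0} {Z W g : ℝ → ℝ}
    (h : IncreasingBiLipschitz K Z W) (hab : a ≤ b) (hf : IntervalIntegrable f volume a b)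
    (hfZ : IntervalIntegrable f volume (Z a) (Z b)) (hg : Continuous g) {δ : ℝ}
    (hgZ : ∀ᵐ y, |g (Z y) * deriv Z y - g y| ≤ δ) :
    ∫ y in a..b, |f (Z y) * deriv Z y - f y|
      ≤ (∫ y in Z a..Z b, |f y - g y|) + (b - a) * δ + ∫ y in a..b, |f y - g y| := by
  have hint := (hf.sub (hg.intervalIntegrable a b)).abs
  have hint_comp := h.intervalIntegrable_comp_mul_deriv hab
    (hfZ.sub (hg.intervalIntegrable (Z a) (Z b))).abs
  have hpt : ∀ᵐ y, |f (Z y) * deriv Z y - f y|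
      ≤ |f (Z y) - g (Z y)| * deriv Z y + δ + |f y - g y| := by
    filter_upwards [hgZ] with y hy
    calc |f (Z y) * deriv Z y - f y|
        = |(f (Z y) - g (Z y)) * deriv Z y + (g (Z y) * deriv Z y - g y) + (g y - f y)| := by
          ring_nf
      _ ≤ |(f (Z y) - g (Z y)) * deriv Z y| + |g (Z y) * deriv Z y - g y| + |g y - f y| :=
          abs_add_three _ _ _
      _ ≤ |f (Z y) - g (Z y)| * deriv Z y + δ + |f y - g y| := by
          rw [abs_mul, abs_of_nonneg (h.deriv_nonneg y), abs_sub_comm (g y)]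
          gcongr
  refine (intervalIntegral.integral_mono_ae hab
    ((h.intervalIntegrable_comp_mul_deriv hab hfZ).sub hf).abs
    ((hint_comp.add intervalIntegrable_const).add hint) hpt).trans_eq ?_
  rw [intervalIntegral.integral_add (hint_comp.add intervalIntegrable_const) hint,
    intervalIntegral.integral_add hint_comp intervalIntegrable_const,
    h.integral_comp_mul_deriv (fun y => |f y - g y|), intervalIntegral.integral_const, smul_eq_mul]

lemma tendsto_integral_abs_comp_mul_deriv_sub (hab : a ≤ b)
    (h : ∀ i, IncreasingBiLipschitz (K i) (Z i) (W i)) (hK : Tendsto K F (𝓝 1))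
    (hη : Tendsto η F (𝓝 0)) (hZ : ∀ i y, |Z i y - y| ≤ η i)
    (hf : IntervalIntegrable f volume (a - 1) (b + 1)) :
    Tendsto (fun i => ∫ y in a..b, |f (Z i y) * deriv (Z i) y - f y|) F (𝓝 0) := by
  rw [Metric.tendsto_nhds]
  intro ε hε
  have _ : 0 < b - a + 1 := by linarith
  obtain ⟨g, hg, ⟨H, hH⟩, hfg⟩ :=
    exists_uniformContinuous_integral_abs_sub_le (by linarith) hf (ε := ε / 4) (by positivity)
  have hlt : ε / 4 + (b - a) * (ε / (4 * (b - a + 1))) + ε / 4 < ε := by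
    have : (b - a) * (ε / (4 * (b - a + 1))) ≤ ε / 4 := by
      rw [mul_div_assoc', div_le_div_iff₀ (by positivity) (by positivity)]
      nlinarith
    linarith
  have hsub : ∀ {c d}, a - 1 ≤ c → c ≤ d → d ≤ b + 1 → uIcc c d ⊆ uIcc (a - 1) (b + 1) :=
    fun hc hcd hd => by
      rw [uIcc_of_le hcd, uIcc_of_le (hc.trans (hcd.trans hd))]
      exact Icc_subset_Icc hc hd
  have hle : ∀ {c d}, a - 1 ≤ c → c ≤ d → d ≤ b + 1 → ∫ y in c..d, |f y - g y| ≤ ε / 4 :=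
    fun hc hcd hd => (intervalIntegral.integral_mono_interval hc hcd hd
      (Eventually.of_forall fun _ => abs_nonneg _)
      (hf.sub (hg.continuous.intervalIntegrable _ _)).abs).trans hfg
  filter_upwards [hη.eventually_le_const one_pos, eventually_ae_abs_comp_mul_deriv_sub_le h hK hη hZ
    hg hH (ε := ε / (4 * (b - a + 1))) (by positivity)] with i hηi hgi
  rw [Real.dist_eq, sub_zero, abs_of_nonneg
    (intervalIntegral.integral_nonneg hab fun _ _ => abs_nonneg _)]
  have ha : a - 1 ≤ a := by linarith
  have hb : b ≤ b + 1 := by linarith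
  have hZa : a - 1 ≤ Z i a := by linarith [(abs_le.1 ((hZ i a).trans hηi)).1]
  have hZb : Z i b ≤ b + 1 := by linarith [(abs_le.1 ((hZ i b).trans hηi)).2]
  have hZab := (h i).strictMono.monotone hab
  refine (integral_abs_comp_mul_deriv_sub_le (h i) hab (hf.mono_set (hsub ha hab hb))
    (hf.mono_set (hsub hZa hZab hZb)) hg.continuous hgi).trans_lt (lt_of_le_of_lt ?_ hlt)
  gcongr
  exacts [hle hZa hZab hZb, hle ha hab hb]

end Pullback

/-! ### Characteristics -/

lemma dist_trajectory_le {E : Type*} [NormedAddCommGroup E] [NormedSpace ℝ E] {v : ℝ → E → E}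
    {L : ℝ≥0} (hv : ∀ t, LipschitzWith L (v t)) {γ₁ γ₂ : ℝ → E}
    (h₁ : ∀ s, HasDerivAt γ₁ (v s (γ₁ s)) s) (h₂ : ∀ s, HasDerivAt γ₂ (v s (γ₂ s)) s) (s t : ℝ) :
    dist (γ₁ s) (γ₂ s) ≤ dist (γ₁ t) (γ₂ t) * Real.exp (L * |s - t|) := by
  wlog hts : t ≤ s generalizing v γ₁ γ₂ s t
  · -- reverse time
    have hneg : ∀ {γ : ℝ → E}, (∀ s, HasDerivAt γ (v s (γ s)) s) →
        ∀ s, HasDerivAt (fun s => γ (-s)) (-v (-s) (γ (-s))) s := fun h s => by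
      simpa only [neg_smul, one_smul, Function.comp_def] using
        (h (-s)).scomp s (hasDerivAt_neg s)
    have := this (v := fun t x => -v (-t) x) (fun t => (hv (-t)).neg) (hneg h₁) (hneg h₂) (-s) (-t)
      (neg_le_neg (not_le.1 hts).le)
    simpa only [neg_neg, neg_sub_neg, abs_sub_comm t s] using this
  have hcont : ∀ {γ : ℝ → E}, (∀ s, HasDerivAt γ (v s (γ s)) s) → ContinuousOn γ (Icc t s) :=
    fun h => HasDerivAt.continuousOn fun s _ => h s
  rw [abs_of_nonneg (sub_nonneg.2 hts)]
  exact dist_le_of_trajectories_ODE hv (hcont h₁) (fun s _ => (h₁ s).hasDerivWithinAt) (hcont h₂)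
    (fun s _ => (h₂ s).hasDerivWithinAt) le_rfl s ⟨hts, le_rfl⟩

/-- A speed field on the whole plane that is continuous, `L`-Lipschitz in space and takes values
in `[cmin, cmax]` with `cmin > 0`, so that its characteristics are global and move to the right. -/
structure IsSpeed (c : ℝ → ℝ → ℝ) (L : ℝ≥0) (cmin cmax : ℝ) : Prop where
  continuous : Continuous fun z : ℝ × ℝ => c z.1 z.2
  lipschitz : ∀ t, LipschitzWith L (c t)
  min_pos : 0 < cmin
  min_le : ∀ t x, cmin ≤ c t x
  le_max : ∀ t x, c t x ≤ cmax

/-- `Z` is the flow of the speed field `c`: `Z s t y` is the position at time `s` of the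
characteristic that is at `y` at time `t`. -/
structure IsFlow (c : ℝ → ℝ → ℝ) (Z : ℝ → ℝ → ℝ → ℝ) : Prop where
  self : ∀ t y, Z t t y = y
  hasDerivAt : ∀ s t y, HasDerivAt (fun s => Z s t y) (c s (Z s t y)) s

variable {c : ℝ → ℝ → ℝ} {L : ℝ≥0} {cmin cmax : ℝ}

namespace IsSpeed

lemma max_pos (h : IsSpeed c L cmin cmax) : 0 < cmax :=
  h.min_pos.trans_le ((h.min_le 0 0).trans (h.le_max 0 0))

lemma abs_le (h : IsSpeed c L cmin cmax) (t x : ℝ) : |c t x| ≤ cmax := by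
  rw [abs_of_nonneg (h.min_pos.le.trans (h.min_le t x))]
  exact h.le_max t x

lemma comp (h : IsSpeed c L cmin cmax) {m : ℝ → ℝ} (hm : Continuous m) :
    IsSpeed (fun t _ => c t (m t)) 0 cmin cmax where
  continuous := h.continuous.comp (continuous_fst.prodMk (hm.comp continuous_fst))
  lipschitz t := LipschitzWith.const (c t (m t))
  min_pos := h.min_pos
  min_le t _ := h.min_le t _
  le_max t _ := h.le_max t _

lemma exists_trajectory_Ioo (h : IsSpeed c L cmin cmax) (t y : ℝ) {N : ℝ} (hN : |t| < N) :
    ∃ γ : ℝ → ℝ, γ t = y ∧ ∀ s ∈ Ioo (-N) N, HasDerivAt γ (c s (γ s)) s := by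
  have ht := abs_lt.1 hN
  have hN0 : 0 ≤ N := (abs_nonneg t).trans hN.le
  have hC := h.max_pos.le
  have hPL : IsPicardLindelof c (tmin := -N) (tmax := N) ⟨t, ht.1.le, ht.2.le⟩ y
      ⟨cmax * (2 * N), by positivity⟩ 0 ⟨cmax, hC⟩ L :=
    { lipschitzOnWith := fun s _ => (h.lipschitz s).lipschitzOnWith
      continuousOn := fun x _ =>
        (h.continuous.comp (by fun_prop : Continuous fun s : ℝ => (s, x))).continuousOn
      norm_le := fun s _ x _ => h.abs_le s x
      mul_max_le := by
        change cmax * max (N - t) (t - -N) ≤ cmax * (2 * N) - 0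
        rw [sub_zero]
        gcongr
        exact max_le (by linarith) (by linarith) }
  obtain ⟨γ, h0, hγ⟩ := hPL.exists_eq_forall_mem_Icc_hasDerivWithinAt₀
  exact ⟨γ, h0, fun s hs => (hγ s (Ioo_subset_Icc_self hs)).hasDerivAt (Icc_mem_nhds hs.1 hs.2)⟩

lemma exists_trajectory (h : IsSpeed c L cmin cmax) (t y : ℝ) :
    ∃ γ : ℝ → ℝ, γ t = y ∧ ∀ s, HasDerivAt γ (c s (γ s)) s := by
  -- glue the trajectories `γ s` on the growing intervals `I s`, which agree by uniqueness
  let I : ℝ → Set ℝ := fun s => Ioo (-(|s| + |t| + 1)) (|s| + |t| + 1)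
  have ht : ∀ s : ℝ, |t| < |s| + |t| + 1 := fun s => by linarith [abs_nonneg s]
  choose γ hγt hγ using fun s : ℝ => h.exists_trajectory_Ioo t y (ht s)
  have hmem : ∀ {s s' : ℝ}, |s'| ≤ |s| → s' ∈ I s := fun hs =>
    abs_lt.1 (by linarith [abs_nonneg t])
  have hagree : ∀ {s s' : ℝ}, |s'| ≤ |s| → γ s' s' = γ s s' := fun {s s'} hs => by
    have hsub : I s' ⊆ I s := Ioo_subset_Ioo (by linarith) (by linarith)
    exact ODE_solution_unique_of_mem_Ioo (s := fun _ => univ)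
      (fun σ _ => (h.lipschitz σ).lipschitzOnWith)
      (abs_lt.1 (ht s')) (fun σ hσ => ⟨hγ s' σ hσ, trivial⟩)
      (fun σ hσ => ⟨hγ s σ (hsub hσ), trivial⟩) ((hγt s').trans (hγt s).symm) (hmem le_rfl)
  refine ⟨fun s => γ s s, hγt t, fun s => ?_⟩
  have hs : |s| < abs (|s| + 1) := (lt_add_one _).trans_le (le_abs_self _)
  have hderiv := hγ (|s| + 1) s (hmem hs.le)
  rw [← hagree hs.le] at hderiv
  refine hderiv.congr_of_eventuallyEq ?_
  filter_upwards [continuous_abs.continuousAt.eventually_lt_const hs] with s' hs'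
  exact hagree hs'.le

lemma exists_flow (h : IsSpeed c L cmin cmax) : ∃ Z, IsFlow c Z := by
  choose Z hself hZ using h.exists_trajectory
  exact ⟨fun s t y => Z t y s, hself, fun s t y => hZ t y s⟩

end IsSpeed

/-- The Lipschitz constant of the flow of an `L`-Lipschitz speed field from time `t` to time `s`. -/
noncomputable def flowConst (L : ℝ≥0) (s t : ℝ) : ℝ≥0 := (Real.exp (L * |s - t|)).toNNReal

lemma coe_flowConst (L : ℝ≥0) (s t : ℝ) : (flowConst L s t : ℝ) = Real.exp (L * |s - t|) :=
  Real.coe_toNNReal _ (Real.exp_pos _).le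

lemma continuous_flowConst (L : ℝ≥0) (s : ℝ) : Continuous (flowConst L s) :=
  continuous_real_toNNReal.comp (by fun_prop)

lemma flowConst_comm (L : ℝ≥0) (s t : ℝ) : flowConst L s t = flowConst L t s := by
  rw [flowConst, abs_sub_comm, flowConst]

lemma flowConst_self (L : ℝ≥0) (s : ℝ) : flowConst L s s = 1 := by
  rw [flowConst, sub_self, abs_zero, mul_zero, Real.exp_zero, Real.toNNReal_one]

namespace IsFlow

variable {Z : ℝ → ℝ → ℝ → ℝ}

lemma lipschitzWith (hZ : IsFlow c Z) (h : IsSpeed c L cmin cmax) (s t : ℝ) :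
    LipschitzWith (flowConst L s t) (Z s t) := .of_dist_le_mul fun y y' => by
  have := dist_trajectory_le h.lipschitz (fun s => hZ.hasDerivAt s t y)
    (fun s => hZ.hasDerivAt s t y') s t
  rwa [hZ.self, hZ.self, mul_comm, ← coe_flowConst] at this

lemma comp (hZ : IsFlow c Z) (h : IsSpeed c L cmin cmax) (s t r y : ℝ) :
    Z s t (Z t r y) = Z s r y := by
  have := dist_trajectory_le h.lipschitz (fun s => hZ.hasDerivAt s t (Z t r y))
    (fun s => hZ.hasDerivAt s r y) s t
  rw [hZ.self, dist_self, zero_mul] at this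
  exact dist_le_zero.1 this

lemma continuous_time (hZ : IsFlow c Z) (t y : ℝ) : Continuous fun s => Z s t y :=
  continuous_iff_continuousAt.2 fun s => (hZ.hasDerivAt s t y).continuousAt

lemma strictMono (hZ : IsFlow c Z) (h : IsSpeed c L cmin cmax) (s t : ℝ) :
    StrictMono (Z s t) := by
  -- two characteristics that exchange their order meet at some time, hence coincide
  intro y y' hy
  by_contra! hle
  obtain ⟨σ, hσ⟩ := mem_range_of_exists_le_of_exists_ge
    ((hZ.continuous_time t y').sub (hZ.continuous_time t y)) (c := 0)
    ⟨s, sub_nonpos.2 hle⟩ ⟨t, by rw [Pi.sub_apply, hZ.self, hZ.self]; exact sub_nonneg.2 hy.le⟩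
  have hmeet : Z σ t y' = Z σ t y := sub_eq_zero.1 hσ
  have hback := hZ.comp h t σ t y
  rw [← hmeet, hZ.comp h, hZ.self, hZ.self] at hback
  exact hy.ne' hback

lemma increasingBiLipschitz (hZ : IsFlow c Z) (h : IsSpeed c L cmin cmax) (s t : ℝ) :
    IncreasingBiLipschitz (flowConst L s t) (Z s t) (Z t s) where
  strictMono := hZ.strictMono h s t
  lipschitz := hZ.lipschitzWith h s t
  lipschitz_inv := flowConst_comm L s t ▸ hZ.lipschitzWith h t s
  left_inv y := by rw [hZ.comp h, hZ.self]
  right_inv y := by rw [hZ.comp h, hZ.self]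

lemma abs_sub_time_le (hZ : IsFlow c Z) (h : IsSpeed c L cmin cmax) (s s' t y : ℝ) :
    |Z s t y - Z s' t y| ≤ cmax * |s - s'| :=
  convex_univ.norm_image_sub_le_of_norm_hasDerivWithin_le
    (fun σ _ => (hZ.hasDerivAt σ t y).hasDerivWithinAt) (fun σ _ => h.abs_le σ _)
    (mem_univ s') (mem_univ s)

lemma continuous_uncurry (hZ : IsFlow c Z) (h : IsSpeed c L cmin cmax) (t : ℝ) :
    Continuous fun z : ℝ × ℝ => Z z.1 t z.2 := by
  refine continuous_iff_continuousAt.2 fun z₀ => tendsto_iff_dist_tendsto_zero.2 ?_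
  have hbound : Continuous fun z : ℝ × ℝ =>
      flowConst L z.1 t * dist z.2 z₀.2 + cmax * |z.1 - z₀.1| := by
    simp_rw [coe_flowConst]
    fun_prop
  refine squeeze_zero (fun _ => dist_nonneg) (fun z => (dist_triangle _ (Z z.1 t z₀.2) _).trans
    (add_le_add ((hZ.lipschitzWith h z.1 t).dist_le_mul _ _) (hZ.abs_sub_time_le h _ _ _ _))) ?_
  simpa only [dist_self, sub_self, abs_zero, mul_zero, add_zero] using hbound.tendsto z₀

lemma strictMono_time (hZ : IsFlow c Z) (h : IsSpeed c L cmin cmax) (t y : ℝ) :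
    StrictMono fun s => Z s t y :=
  strictMono_of_hasDerivAt_pos (fun s => hZ.hasDerivAt s t y)
    fun _ => h.min_pos.trans_le (h.min_le _ _)

lemma eq_sub_integral (hZ : IsFlow c Z) (h : IsSpeed c L cmin cmax) (s t y : ℝ) :
    Z s t y = y - ∫ σ in s..t, c σ (Z σ t y) := by
  have hcont : Continuous fun σ => c σ (Z σ t y) :=
    h.continuous.comp (continuous_id.prodMk (hZ.continuous_time t y))
  rw [intervalIntegral.integral_eq_sub_of_hasDerivAt (fun σ _ => hZ.hasDerivAt σ t y)
    (hcont.intervalIntegrable _ _), hZ.self]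
  ring

end IsFlow

section Travel

variable {a : ℝ → ℝ} {amin amax : ℝ}

/-- A Lipschitz constant for both a function and its inverse if the derivative of the function
lies in `[amin, amax]`. -/
noncomputable def biLipschitzConst (amin amax : ℝ) : ℝ≥0 := max amin⁻¹.toNNReal amax.toNNReal

lemma increasingBiLipschitz_of_hasDerivAt {A : ℝ → ℝ} (hA : ∀ t, HasDerivAt A (a t) t)
    (h0 : 0 < amin) (hmin : ∀ t, amin ≤ a t) (hmax : ∀ t, a t ≤ amax) :
    IncreasingBiLipschitz (biLipschitzConst amin amax) A (Function.invFun A) := by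
  have hdiff : Differentiable ℝ A := fun t => (hA t).differentiableAt
  have hlower : ∀ {s t}, s ≤ t → amin * (t - s) ≤ A t - A s := fun {s t} hst =>
    mul_sub_le_image_sub_of_le_deriv hdiff (fun t => (hA t).deriv ▸ hmin t) hst
  have hmono : StrictMono A := strictMono_of_hasDerivAt_pos hA fun t => h0.trans_le (hmin t)
  have hsurj : Function.Surjective A := by
    refine hdiff.continuous.surjective ?_ ?_
    · refine tendsto_atTop_mono' _ ?_ (tendsto_atTop_add_const_left _ (A 0)
        (tendsto_id.const_mul_atTop h0))
      filter_upwards [eventually_ge_atTop 0] with t ht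
      simp only [id]
      linarith [hlower ht]
    · refine tendsto_atBot_mono' _ ?_ (tendsto_atBot_add_const_left _ (A 0)
        (tendsto_id.const_mul_atBot h0))
      filter_upwards [eventually_le_atBot 0] with t ht
      simp only [id]
      linarith [hlower ht]
  have hright : ∀ x, A (Function.invFun A x) = x := Function.rightInverse_invFun hsurj
  refine ⟨hmono, ?_, ?_, Function.leftInverse_invFun hmono.injective, hright⟩
  · refine lipschitzWith_of_nnnorm_deriv_le hdiff fun t => ?_
    rw [(hA t).deriv, ← NNReal.coe_le_coe, coe_nnnorm, Real.norm_eq_abs,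
      abs_of_nonneg (h0.le.trans (hmin t))]
    exact (hmax t).trans ((Real.le_coe_toNNReal _).trans (NNReal.coe_le_coe.2 (le_max_right _ _)))
  · refine (AntilipschitzWith.of_le_mul_dist (K := amin⁻¹.toNNReal) fun s t => ?_).to_rightInverse
      hright |>.weaken (le_max_left _ _)
    rw [Real.coe_toNNReal _ (inv_pos.2 h0).le, ← div_eq_inv_mul, le_div_iff₀ h0, mul_comm]
    wlog hst : s ≤ t generalizing s t
    · simpa only [dist_comm] using this t s (not_le.1 hst).le
    rw [dist_comm, dist_comm (A s), Real.dist_eq, Real.dist_eq, abs_of_nonneg (sub_nonneg.2 hst)]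
    exact (hlower hst).trans (le_abs_self _)

/-- The distance travelled up to time `t` at speed `a`. -/
noncomputable def travel (a : ℝ → ℝ) (t : ℝ) : ℝ := ∫ s in (0 : ℝ)..t, a s

/-- The time needed to travel a given distance at speed `a`. -/
noncomputable def arrival (a : ℝ → ℝ) : ℝ → ℝ := Function.invFun (travel a)

lemma travel_zero (a : ℝ → ℝ) : travel a 0 = 0 := intervalIntegral.integral_same

lemma IsSpeed.increasingBiLipschitz_travel (h : IsSpeed (fun t _ => a t) L amin amax) :
    IncreasingBiLipschitz (biLipschitzConst amin amax) (travel a) (arrival a) :=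
  increasingBiLipschitz_of_hasDerivAt (hasDerivAt_integral_of_continuous
    (h.continuous.comp (f := fun t : ℝ => (t, (0 : ℝ))) (by fun_prop)) 0) h.min_pos
    (fun t => h.min_le t 0) fun t => h.le_max t 0

lemma IsFlow.apply_zero_eq_neg_travel {Z : ℝ → ℝ → ℝ → ℝ} (hZ : IsFlow c Z)
    (h : IsSpeed c L cmin cmax) (hc : ∀ t, ∀ x ≤ 0, c t x = c t 0) {t : ℝ} (ht : 0 ≤ t) :
    Z 0 t 0 = -travel (fun t => c t 0) t := by
  rw [hZ.eq_sub_integral h, zero_sub, travel]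
  congr 1
  refine intervalIntegral.integral_congr fun σ hσ => hc _ _ ?_
  rw [uIcc_of_le ht] at hσ
  exact ((hZ.strictMono_time h t 0).monotone hσ.2).trans_eq (hZ.self t 0)

end Travel

/-! ### Transport along characteristics -/

/-- The density at time `t` obtained by transporting the density `m` at time `0` along `Z`. -/
noncomputable def transported (Z : ℝ → ℝ → ℝ → ℝ) (m : ℝ → ℝ) (t y : ℝ) : ℝ :=
  m (Z 0 t y) * deriv (Z 0 t) y

namespace IsFlow

variable {c : ℝ → ℝ → ℝ} {L : ℝ≥0} {cmin cmax : ℝ} {Z : ℝ → ℝ → ℝ → ℝ} {m : ℝ → ℝ} {M a b : ℝ}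

lemma boundedMeasurable_transported (hZ : IsFlow c Z) (h : IsSpeed c L cmin cmax)
    (hm : BoundedMeasurable M m) (t : ℝ) :
    BoundedMeasurable (M * flowConst L 0 t) (transported Z m t) :=
  (hZ.increasingBiLipschitz h 0 t).boundedMeasurable_comp_mul_deriv hm

lemma transported_nonneg (hZ : IsFlow c Z) (h : IsSpeed c L cmin cmax) (hm : ∀ x, 0 ≤ m x)
    (t y : ℝ) : 0 ≤ transported Z m t y :=
  mul_nonneg (hm _) ((hZ.increasingBiLipschitz h 0 t).deriv_nonneg y)

lemma integral_transported (hZ : IsFlow c Z) (h : IsSpeed c L cmin cmax) (m : ℝ → ℝ)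
    (t a b : ℝ) : ∫ y in a..b, transported Z m t y = ∫ x in Z 0 t a..Z 0 t b, m x :=
  (hZ.increasingBiLipschitz h 0 t).integral_comp_mul_deriv m a b

lemma transported_ae_eq (hZ : IsFlow c Z) (h : IsSpeed c L cmin cmax) (m : ℝ → ℝ) (s t : ℝ) :
    ∀ᵐ y, transported Z m t y = transported Z m s (Z s t y) * deriv (Z s t) y := by
  have hst := hZ.increasingBiLipschitz h s t
  have h0s := hZ.increasingBiLipschitz h 0 s
  filter_upwards [hst.lipschitz.ae_differentiableAt_real,
    hst.ae_comp h0s.lipschitz.ae_differentiableAt_real] with y hy hy'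
  have hcomp : Z 0 t = Z 0 s ∘ Z s t := funext fun y => (hZ.comp h 0 s t y).symm
  rw [transported, transported, hcomp, deriv_comp y hy' hy, Function.comp, mul_assoc]

lemma continuousInL1On_transported (hZ : IsFlow c Z) (h : IsSpeed c L cmin cmax) (hab : a ≤ b)
    (hm : BoundedMeasurable M m) (S : Set ℝ) : ContinuousInL1On S a b (transported Z m) := by
  intro s _
  have hs := hZ.boundedMeasurable_transported h hm s
  have hK : Tendsto (flowConst L s) (𝓝[S] s) (𝓝 1) :=
    flowConst_self L s ▸ (continuous_flowConst L s).continuousWithinAt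
  have hη : Tendsto (fun t => cmax * |s - t|) (𝓝[S] s) (𝓝 0) := by
    have hcont : Continuous fun t => cmax * |s - t| := by fun_prop
    simpa only [sub_self, abs_zero, mul_zero] using
      (hcont.continuousWithinAt (s := S) (x := s)).tendsto
  have hdist : ∀ t y, |Z s t y - y| ≤ cmax * |s - t| := fun t y => by
    simpa only [hZ.self] using hZ.abs_sub_time_le h s t t y
  refine ⟨hs.intervalIntegrable a b, (tendsto_integral_abs_comp_mul_deriv_sub hab
    (fun t => hZ.increasingBiLipschitz h s t) hK hη hdist
    (hs.intervalIntegrable _ _)).congr fun t => ?_⟩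
  refine intervalIntegral.integral_congr_ae ?_
  filter_upwards [hZ.transported_ae_eq h m s t] with y hy _
  rw [hy]

lemma integral_transported_mul (hZ : IsFlow c Z) (h : IsSpeed c L cmin cmax) (m : ℝ → ℝ) {t : ℝ}
    {g : ℝ → ℝ} (hab : a ≤ b) (hg : ∀ y, b ≤ y → g y = 0) {α β : ℝ} (hα : α ≤ Z 0 t a)
    (hβ : Z 0 t b ≤ β) :
    ∫ y in a..b, transported Z m t y * g y
      = ∫ x in α..β, (Ioi (Z 0 t a)).indicator (fun x => m x * g (Z t 0 x)) x := by
  have hbi := hZ.increasingBiLipschitz h 0 t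
  have hZab : Z 0 t a ≤ Z 0 t b := hbi.strictMono.monotone hab
  calc ∫ y in a..b, transported Z m t y * g y
      = ∫ y in a..b, (m (Z 0 t y) * g (Z t 0 (Z 0 t y))) * deriv (Z 0 t) y := by
        simp only [transported, hbi.left_inv, mul_right_comm]
    _ = ∫ x in Z 0 t a..Z 0 t b, m x * g (Z t 0 x) :=
        hbi.integral_comp_mul_deriv (fun x => m x * g (Z t 0 x)) a b
    _ = ∫ x in α..β, (Ioi (Z 0 t a)).indicator (fun x => m x * g (Z t 0 x)) x := by
        rw [intervalIntegral.integral_of_le hZab,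
          intervalIntegral.integral_of_le (hα.trans (hZab.trans hβ)),
          setIntegral_indicator measurableSet_Ioi, Ioc_inter_Ioi, max_eq_right hα]
        refine (setIntegral_eq_of_subset_of_forall_sdiff_eq_zero measurableSet_Ioc
          (Ioc_subset_Ioc_right hβ) fun x hx => ?_).symm
        have hx' : Z 0 t b < x := lt_of_not_ge fun hle => hx.2 ⟨hx.1.1, hle⟩
        rw [hg _ (hbi.left_inv b ▸ hbi.symm.strictMono.monotone hx'.le), mul_zero]

end IsFlow

section EntryData

variable {K : ℝ≥0} {A B q₀ u : ℝ → ℝ} {M t : ℝ}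

/-- The density at time `0` on the whole line whose transport has initial datum `q₀` on `0 < x` and
inflow `u` at `0`, when `B d` is the time at which the characteristic starting from `-d` reaches
`0`. -/
noncomputable def entryData (B q₀ u : ℝ → ℝ) (x : ℝ) : ℝ :=
  if 0 < x then q₀ x else u (B (-x)) * deriv B (-x)

/-- The time from which on the characteristic starting from `x` at time `0` is on the road. -/
noncomputable def entryTime (B : ℝ → ℝ) (x : ℝ) : ℝ := B (max (-x) 0)

lemma boundedMeasurable_entryData (hA : IncreasingBiLipschitz K A B)
    (hq : BoundedMeasurable M q₀) (hu : BoundedMeasurable M u) :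
    BoundedMeasurable (M + M * K) (entryData B q₀ u) where
  measurable := Measurable.ite measurableSet_Ioi hq.measurable
    ((hA.symm.boundedMeasurable_comp_mul_deriv hu).measurable.comp measurable_neg)
  abs_le x := by
    rw [entryData]
    split_ifs
    · exact (hq.abs_le x).trans
        (le_add_of_nonneg_right (mul_nonneg hq.bound_nonneg K.coe_nonneg))
    · exact ((hA.symm.boundedMeasurable_comp_mul_deriv hu).abs_le (-x)).trans
        (le_add_of_nonneg_left hq.bound_nonneg)

lemma entryData_nonneg (hA : IncreasingBiLipschitz K A B) (hq : ∀ x, 0 ≤ q₀ x)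
    (hu : ∀ t, 0 ≤ u t) (x : ℝ) : 0 ≤ entryData B q₀ u x := by
  rw [entryData]
  split_ifs
  · exact hq x
  · exact mul_nonneg (hu _) (hA.symm.deriv_nonneg _)

lemma integral_entryData_mul_of_nonneg (B q₀ u g : ℝ → ℝ) {a b : ℝ} (ha : 0 ≤ a)
    (hab : a ≤ b) : ∫ x in a..b, entryData B q₀ u x * g x = ∫ x in a..b, q₀ x * g x := by
  refine intervalIntegral.integral_congr_ae (Eventually.of_forall fun x hx => ?_)
  rw [uIoc_of_le hab] at hx
  rw [entryData, if_pos (ha.trans_lt hx.1)]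

lemma integral_entryData_mul_of_nonpos (hA : IncreasingBiLipschitz K A B) (q₀ u g : ℝ → ℝ)
    {a b : ℝ} (ha : 0 ≤ a) (hab : a ≤ b) :
    ∫ x in -b..-a, entryData B q₀ u x * g (B (-x)) = ∫ σ in B a..B b, u σ * g σ := by
  rw [← hA.symm.integral_comp_mul_deriv, ← intervalIntegral.integral_comp_neg]
  refine intervalIntegral.integral_congr fun x hx => ?_
  rw [uIcc_of_le hab] at hx
  simp only [entryData, if_neg (not_lt.2 (neg_nonpos.2 (ha.trans hx.1))), neg_neg]
  ring

lemma entryTime_nonneg (hA : IncreasingBiLipschitz K A B) (hA0 : A 0 = 0) (x : ℝ) :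
    0 ≤ entryTime B x := by
  rw [← hA.left_inv 0, hA0]
  exact hA.symm.strictMono.monotone (le_max_right _ _)

lemma entryTime_lt_iff (hA : IncreasingBiLipschitz K A B) (hA0 : A 0 = 0) (ht : 0 < t) :
    entryTime B x < t ↔ -A t < x := by
  have hAt : 0 < A t := hA0 ▸ hA.strictMono ht
  rw [← hA.strictMono.lt_iff_lt, entryTime, hA.right_inv, max_lt_iff, and_iff_left hAt, neg_lt]

end EntryData

section WeakForm

variable {T ℓ : ℝ} {c : ℝ → ℝ → ℝ} {L K : ℝ≥0} {cmin cmax : ℝ} {Z : ℝ → ℝ → ℝ → ℝ}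
  {A B q₀ u m : ℝ → ℝ} {M : ℝ} {φ : ℝ × ℝ → ℝ}

/-- The derivative `∂ₜ φ + c ∂ₓ φ` along the characteristics of `c`. -/
noncomputable def materialDeriv (c : ℝ → ℝ → ℝ) (φ : ℝ × ℝ → ℝ) (t x : ℝ) : ℝ :=
  fderiv ℝ φ (t, x) (1, 0) + c t x * fderiv ℝ φ (t, x) (0, 1)

lemma IsSpeed.continuous_materialDeriv (h : IsSpeed c L cmin cmax) (hφ : ContDiff ℝ 1 φ) :
    Continuous fun z : ℝ × ℝ => materialDeriv c φ z.1 z.2 := by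
  have hfderiv : Continuous (fderiv ℝ φ) := hφ.continuous_fderiv one_ne_zero
  exact (hfderiv.clm_apply continuous_const).add
    (h.continuous.mul (hfderiv.clm_apply continuous_const))

lemma materialDeriv_eq_zero_of_isTestFunction (hφ : IsTestFunction T ℓ φ) (c : ℝ → ℝ → ℝ) {t x : ℝ}
    (hx : ℓ ≤ x) : materialDeriv c φ t x = 0 := by
  have hzero : fderiv ℝ φ (t, x) = 0 :=
    fderiv_of_notMem_tsupport ℝ fun hmem => (hφ.2 hmem).2.not_ge hx
  rw [materialDeriv, hzero, zero_apply, zero_apply, mul_zero, add_zero]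

lemma eq_zero_of_isTestFunction (hφ : IsTestFunction T ℓ φ) {t x : ℝ} (ht : T ≤ t) :
    φ (t, x) = 0 :=
  image_eq_zero_of_notMem_tsupport fun hmem => (hφ.2 hmem).1.not_ge ht

namespace IsFlow

lemma hasDerivAt_comp (hZ : IsFlow c Z) (hφ : ContDiff ℝ 1 φ) (s t x : ℝ) :
    HasDerivAt (fun s => φ (s, Z s t x)) (materialDeriv c φ s (Z s t x)) s := by
  have hpath : HasDerivAt (fun s => (s, Z s t x)) ((1 : ℝ), c s (Z s t x)) s :=
    (hasDerivAt_id s).prodMk (hZ.hasDerivAt s t x)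
  refine ((hφ.differentiable one_ne_zero (s, Z s t x)).hasFDerivAt.comp_hasDerivAt s
    hpath).congr_deriv ?_
  rw [materialDeriv, ← smul_eq_mul, ← map_smul, ← map_add, Prod.smul_mk, Prod.mk_add_mk, smul_zero,
    add_zero, smul_eq_mul, mul_one, zero_add]

lemma integral_materialDeriv (hZ : IsFlow c Z) (h : IsSpeed c L cmin cmax)
    (hφ : IsTestFunction T ℓ φ) (s t x : ℝ) :
    ∫ σ in s..T, materialDeriv c φ σ (Z σ t x) = -φ (s, Z s t x) := by
  have hcont : Continuous fun σ => materialDeriv c φ σ (Z σ t x) :=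
    (h.continuous_materialDeriv hφ.1).comp (continuous_id.prodMk (hZ.continuous_time t x))
  rw [intervalIntegral.integral_eq_sub_of_hasDerivAt (fun σ _ => hZ.hasDerivAt_comp hφ.1 σ t x)
    (hcont.intervalIntegrable _ _), eq_zero_of_isTestFunction hφ le_rfl, zero_sub]

lemma apply_entryTime (hZ : IsFlow c Z) (h : IsSpeed c L cmin cmax)
    (hA : IncreasingBiLipschitz K A B) (hA0 : A 0 = 0) (hZA : ∀ t, 0 ≤ t → Z 0 t 0 = -A t)
    (x : ℝ) : Z (entryTime B x) 0 x = max x 0 := by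
  rcases le_total x 0 with hx | hx
  · have hentry : Z 0 (entryTime B x) 0 = x := by
      rw [hZA _ (entryTime_nonneg hA hA0 x), entryTime, hA.right_inv,
        max_eq_left (neg_nonneg.2 hx), neg_neg]
    nth_rw 2 [← hentry]
    rw [hZ.comp h, hZ.self, max_eq_right hx]
  · have hB0 : B 0 = 0 := by rw [← hA0, hA.left_inv, hA0]
    rw [entryTime, max_eq_right (neg_nonpos.2 hx), hB0, hZ.self, max_eq_left hx]

lemma integral_materialDeriv_entryTime (hZ : IsFlow c Z) (h : IsSpeed c L cmin cmax)
    (hA : IncreasingBiLipschitz K A B) (hA0 : A 0 = 0) (hZA : ∀ t, 0 ≤ t → Z 0 t 0 = -A t)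
    (hφ : IsTestFunction T ℓ φ) (hT : 0 ≤ T) (x : ℝ) :
    ∫ t in (0 : ℝ)..T, (Ioi (entryTime B x)).indicator
        (fun t => materialDeriv c φ t (Z t 0 x)) t = -φ (entryTime B x, max x 0) := by
  rw [intervalIntegral.integral_of_le hT, setIntegral_indicator measurableSet_Ioi, Ioc_inter_Ioi,
    max_eq_right (entryTime_nonneg hA hA0 x)]
  rcases le_total (entryTime B x) T with hle | hle
  · rw [← intervalIntegral.integral_of_le hle, hZ.integral_materialDeriv h hφ,
      hZ.apply_entryTime h hA hA0 hZA]
  · rw [Ioc_eq_empty hle.not_gt, setIntegral_empty, eq_zero_of_isTestFunction hφ hle, neg_zero]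

end IsFlow

lemma BoundedMeasurable.integrableOn_indicator_mul (hm : BoundedMeasurable M m) {f : ℝ → ℝ}
    (hf : Continuous f) {ψ : ℝ → ℝ → ℝ} (hψ : Continuous fun z : ℝ × ℝ => ψ z.1 z.2)
    (s t α β : ℝ) :
    IntegrableOn (fun z : ℝ × ℝ => (Ioi (f z.1)).indicator (fun x => m x * ψ z.1 x) z.2)
      (uIoc s t ×ˢ uIoc α β) := by
  have hψint : IntegrableOn (fun z : ℝ × ℝ => ψ z.1 z.2) (uIcc s t ×ˢ uIcc α β) :=
    hψ.continuousOn.integrableOn_compact (isCompact_uIcc.prod isCompact_uIcc)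
  have hmul : IntegrableOn (fun z : ℝ × ℝ => m z.2 * ψ z.1 z.2) (uIoc s t ×ˢ uIoc α β) :=
    (hψint.mono_set (prod_mono uIoc_subset_uIcc uIoc_subset_uIcc)).bdd_mul
      (hm.measurable.comp measurable_snd).aestronglyMeasurable
      (Eventually.of_forall fun z => hm.abs_le z.2)
  exact hmul.indicator (measurableSet_lt (hf.measurable.comp measurable_fst) measurable_snd)

lemma IsFlow.integral_integral_transported_mul (hZ : IsFlow c Z) (h : IsSpeed c L cmin cmax)
    (hA : IncreasingBiLipschitz K A B) (hA0 : A 0 = 0) (hZA : ∀ t, 0 ≤ t → Z 0 t 0 = -A t)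
    (hT : 0 ≤ T) (hℓ : 0 ≤ ℓ) (hm : BoundedMeasurable M m) (hφ : IsTestFunction T ℓ φ) :
    ∫ t in (0 : ℝ)..T, ∫ y in (0 : ℝ)..ℓ, transported Z m t y * materialDeriv c φ t y
      = ∫ x in -A T..ℓ, m x * -φ (entryTime B x, max x 0) := by
  let F : ℝ → ℝ → ℝ := fun t =>
    (Ioi (-A t)).indicator fun x => m x * materialDeriv c φ t (Z t 0 x)
  have hslice : ∀ t ∈ Icc 0 T,
      ∫ y in (0 : ℝ)..ℓ, transported Z m t y * materialDeriv c φ t y = ∫ x in -A T..ℓ, F t x :=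
    fun t ht => by
      have hin : -A T ≤ Z 0 t 0 :=
        (neg_le_neg (hA.strictMono.monotone ht.2)).trans_eq (hZA t ht.1).symm
      have hout : Z 0 t ℓ ≤ ℓ := by
        simpa only [hZ.self] using (hZ.strictMono_time h t ℓ).monotone ht.1
      rw [hZ.integral_transported_mul h m hℓ
        (fun y hy => materialDeriv_eq_zero_of_isTestFunction hφ c hy) hin hout, hZA t ht.1]
  have hfubini : IntegrableOn F.uncurry (uIoc 0 T ×ˢ uIoc (-A T) ℓ) :=
    hm.integrableOn_indicator_mul (ψ := fun t x => materialDeriv c φ t (Z t 0 x))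
      hA.lipschitz.continuous.neg
      ((h.continuous_materialDeriv hφ.1).comp
        (continuous_fst.prodMk (hZ.continuous_uncurry h 0))) _ _ _ _
  have hswitch : ∀ x, ∀ t ∈ Ioc 0 T,
      F t x = m x * (Ioi (entryTime B x)).indicator
        (fun t => materialDeriv c φ t (Z t 0 x)) t := fun x t ht => by
    simp only [F, indicator_apply, mem_Ioi, entryTime_lt_iff hA hA0 ht.1, mul_ite, mul_zero]
  calc ∫ t in (0 : ℝ)..T, ∫ y in (0 : ℝ)..ℓ, transported Z m t y * materialDeriv c φ t y
      = ∫ t in (0 : ℝ)..T, ∫ x in -A T..ℓ, F t x := by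
        refine intervalIntegral.integral_congr fun t ht => hslice t ?_
        rwa [uIcc_of_le hT] at ht
    _ = ∫ x in -A T..ℓ, ∫ t in (0 : ℝ)..T, F t x := intervalIntegral_intervalIntegral_swap hfubini
    _ = ∫ x in -A T..ℓ, m x * -φ (entryTime B x, max x 0) := by
        refine intervalIntegral.integral_congr fun x _ => ?_
        rw [← hZ.integral_materialDeriv_entryTime h hA hA0 hZA hφ hT,
          ← intervalIntegral.integral_const_mul]
        refine intervalIntegral.integral_congr_ae (Eventually.of_forall fun t ht => hswitch x t ?_)
        rwa [uIoc_of_le hT] at ht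

theorem IsFlow.weakForm_transported (hZ : IsFlow c Z) (h : IsSpeed c L cmin cmax)
    (hA : IncreasingBiLipschitz K A B) (hZA : ∀ t, 0 ≤ t → Z 0 t 0 = -A t) (hT : 0 ≤ T)
    (hℓ : 0 ≤ ℓ) (hq : BoundedMeasurable M q₀) (hu : BoundedMeasurable M u) :
    WeakForm T ℓ c q₀ u (transported Z (entryData B q₀ u)) := by
  intro φ hφ
  have hA0 : A 0 = 0 := by simpa only [hZ.self, zero_eq_neg] using hZA 0 le_rfl
  have hB0 : B 0 = 0 := by rw [← hA0, hA.left_inv, hA0]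
  have hAT : 0 ≤ A T := hA0 ▸ hA.strictMono.monotone hT
  have hm := boundedMeasurable_entryData hA hq hu
  set m := entryData B q₀ u
  set g : ℝ → ℝ := fun x => φ (entryTime B x, max x 0) with hg
  have hgcont : Continuous g := by
    have hB := hA.lipschitz_inv.continuous
    have hφcont := hφ.1.continuous
    unfold g entryTime
    fun_prop
  have hmg : ∀ a b, IntervalIntegrable (fun x => m x * g x) volume a b := fun a b =>
    (hm.intervalIntegrable a b).mul_continuousOn hgcont.continuousOn
  have hinflow : ∫ x in -A T..0, m x * g x = ∫ t in (0 : ℝ)..T, u t * φ (t, 0) := by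
    have := integral_entryData_mul_of_nonpos hA q₀ u (fun t => φ (t, 0)) le_rfl hAT
    rw [neg_zero, hB0, hA.left_inv] at this
    rw [← this]
    refine intervalIntegral.integral_congr fun x hx => ?_
    rw [uIcc_of_le (neg_nonpos.2 hAT)] at hx
    simp only [hg, m, entryTime, max_eq_left (neg_nonneg.2 hx.2), max_eq_right hx.2]
  have hinitial : ∫ x in (0 : ℝ)..ℓ, m x * g x = ∫ x in (0 : ℝ)..ℓ, q₀ x * φ (0, x) := by
    rw [integral_entryData_mul_of_nonneg B q₀ u g le_rfl hℓ]
    refine intervalIntegral.integral_congr fun x hx => ?_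
    rw [uIcc_of_le hℓ] at hx
    simp only [hg, entryTime, max_eq_right (neg_nonpos.2 hx.1), max_eq_left hx.1, hB0]
  change (∫ t in (0 : ℝ)..T, ∫ y in (0 : ℝ)..ℓ, transported Z m t y * materialDeriv c φ t y)
    + _ + _ = 0
  simp only [hZ.integral_integral_transported_mul h hA hA0 hZA hT hℓ hm hφ, mul_neg,
    intervalIntegral.integral_neg]
  rw [← intervalIntegral.integral_add_adjacent_intervals (hmg (-A T) 0) (hmg 0 ℓ), hinflow,
    hinitial]
  ring

end WeakForm

/-! ### Volterra equations and the mass on the road -/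

lemma integral_le_exp_mul_div {f : ℝ → ℝ} {k t D : ℝ} (hk : 0 < k) (ht : 0 ≤ t) (hD : 0 ≤ D)
    (hf : IntervalIntegrable f volume 0 t) (hle : ∀ s ∈ Icc 0 t, f s ≤ Real.exp (k * s) * D) :
    ∫ s in (0 : ℝ)..t, f s ≤ Real.exp (k * t) * (D / k) :=
  calc ∫ s in (0 : ℝ)..t, f s ≤ ∫ s in (0 : ℝ)..t, Real.exp (k * s) * D :=
        intervalIntegral.integral_mono_on ht hf
          (Continuous.intervalIntegrable (by fun_prop) _ _) hle
    _ = (Real.exp (k * t) - 1) / k * D := by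
        rw [intervalIntegral.integral_mul_const, intervalIntegral.integral_comp_mul_left
          (fun x => Real.exp x) hk.ne', integral_exp, mul_zero, Real.exp_zero, smul_eq_mul,
          inv_mul_eq_div]
    _ ≤ Real.exp (k * t) / k * D := by gcongr; exact sub_le_self _ zero_le_one
    _ = Real.exp (k * t) * (D / k) := by ring

section Volterra

variable {E : Type*} [NormedAddCommGroup E] [NormedSpace ℝ E] {T k : ℝ}

/-- The extension to the line of a curve on `[0, T]`, weighted by `exp (k t)`: in the norms obtained
in this way Volterra operators become contractions. -/
noncomputable def expExtend (hT : 0 ≤ T) (k : ℝ) (η : C(Icc (0 : ℝ) T, E)) (t : ℝ) : E :=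
  Real.exp (k * t) • IccExtend hT η t

lemma continuous_expExtend (hT : 0 ≤ T) (k : ℝ) (η : C(Icc (0 : ℝ) T, E)) :
    Continuous (expExtend hT k η) :=
  (by fun_prop : Continuous fun t : ℝ => Real.exp (k * t)).smul η.continuous.Icc_extend'

lemma integral_norm_expExtend_sub_le (hT : 0 ≤ T) (hk : 0 < k) (η₁ η₂ : C(Icc (0 : ℝ) T, E))
    {t : ℝ} (ht : 0 ≤ t) :
    ∫ s in (0 : ℝ)..t, ‖expExtend hT k η₁ s - expExtend hT k η₂ s‖
      ≤ Real.exp (k * t) * (dist η₁ η₂ / k) := by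
  refine integral_le_exp_mul_div hk ht dist_nonneg
    (((continuous_expExtend hT k η₁).sub (continuous_expExtend hT k η₂)).norm.intervalIntegrable
      _ _) fun s _ => ?_
  rw [expExtend, expExtend, ← smul_sub, norm_smul, Real.norm_eq_abs, Real.abs_exp,
    ← dist_eq_norm]
  gcongr
  exact ContinuousMap.dist_apply_le_dist (f := η₁) (g := η₂) (projIcc 0 T hT s)

theorem exists_fixedPoint_volterra [CompleteSpace E] (hT : 0 ≤ T) {G : (ℝ → E) → ℝ → E}
    (hGc : ∀ w, Continuous w → Continuous (G w)) {K : ℝ} (hK : 0 ≤ K)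
    (hG : ∀ w₁ w₂, Continuous w₁ → Continuous w₂ → ∀ t ∈ Icc 0 T,
      ‖G w₁ t - G w₂ t‖ ≤ K * ∫ s in (0 : ℝ)..t, ‖w₁ s - w₂ s‖) :
    ∃ w, Continuous w ∧ ∀ t ∈ Icc 0 T, w t = G w t := by
  set k : ℝ := 2 * K + 1
  have hk : 0 < k := by positivity
  have hKk : K / k ≤ 1 / 2 := by rw [div_le_div_iff₀ hk two_pos]; linarith
  have hw := continuous_expExtend (E := E) hT k
  let Φ : C(Icc (0 : ℝ) T, E) → C(Icc (0 : ℝ) T, E) := fun η =>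
    ⟨fun t => Real.exp (-(k * t)) • G (expExtend hT k η) t, by have := hGc _ (hw η); fun_prop⟩
  have hcontr : ContractingWith (1 / 2 : ℝ≥0) Φ := by
    refine ⟨NNReal.half_lt_self one_ne_zero, LipschitzWith.of_dist_le_mul fun η₁ η₂ =>
      (ContinuousMap.dist_le (by positivity)).2 fun t => ?_⟩
    calc dist (Φ η₁ t) (Φ η₂ t)
        = Real.exp (-(k * t)) * ‖G (expExtend hT k η₁) t - G (expExtend hT k η₂) t‖ := by
          rw [dist_eq_norm, ContinuousMap.coe_mk, ContinuousMap.coe_mk, ← smul_sub, norm_smul,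
            Real.norm_eq_abs, Real.abs_exp]
      _ ≤ Real.exp (-(k * t)) * (K * (Real.exp (k * t) * (dist η₁ η₂ / k))) := by
          gcongr
          exact (hG _ _ (hw η₁) (hw η₂) t t.2).trans (mul_le_mul_of_nonneg_left
            (integral_norm_expExtend_sub_le hT hk η₁ η₂ t.2.1) hK)
      _ = Real.exp (-(k * t)) * Real.exp (k * t) * (K / k * dist η₁ η₂) := by ring
      _ = K / k * dist η₁ η₂ := by rw [← Real.exp_add, neg_add_cancel, Real.exp_zero, one_mul]
      _ ≤ (1 / 2 : ℝ≥0) * dist η₁ η₂ := by push_cast; gcongr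
  obtain ⟨η, hη⟩ : ∃ η, Φ η = η := ⟨_, hcontr.fixedPoint_isFixedPt⟩
  refine ⟨expExtend hT k η, hw η, fun t ht => ?_⟩
  have hηt : Real.exp (-(k * t)) • G (expExtend hT k η) t = η ⟨t, ht⟩ :=
    DFunLike.congr_fun hη ⟨t, ht⟩
  rw [expExtend, IccExtend_of_mem _ _ ht, ← hηt, smul_smul, ← Real.exp_add, add_neg_cancel,
    Real.exp_zero, one_smul]

end Volterra

section RoadMass

variable {ℓ M T t : ℝ} {K : ℝ≥0} {A A₁ A₂ B B₁ B₂ ρ₀ u : ℝ → ℝ}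

/-- The mass on the road `[0, ℓ]` at time `t` when all the traffic has moved by `A t` since time
`0`: the vehicles present initially that have not yet left, and those that have entered since the
vehicle now at `ℓ`. -/
noncomputable def roadMass (ℓ : ℝ) (ρ₀ u A B : ℝ → ℝ) (t : ℝ) : ℝ :=
  (∫ x in (0 : ℝ)..max (ℓ - A t) 0, ρ₀ x) + ∫ s in entryTime B (ℓ - A t)..t, u s

lemma entryTime_le (hA : IncreasingBiLipschitz K A B) (hA0 : A 0 = 0) (ht : 0 ≤ t) {x : ℝ}
    (hx : -A t ≤ x) : entryTime B x ≤ t := by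
  have hAt : 0 ≤ A t := hA0 ▸ hA.strictMono.monotone ht
  exact (hA.symm.strictMono.monotone (max_le (neg_le.1 hx) hAt)).trans_eq (hA.left_inv t)

lemma abs_entryTime_sub_le (hA₁ : IncreasingBiLipschitz K A₁ B₁)
    (hA₂ : IncreasingBiLipschitz K A₂ B₂) (x₁ x₂ : ℝ) :
    |entryTime B₁ x₁ - entryTime B₂ x₂|
      ≤ K * (|x₁ - x₂| + |A₁ (entryTime B₂ x₂) - A₂ (entryTime B₂ x₂)|) := by
  set τ := entryTime B₂ x₂
  have hτ : A₂ τ = max (-x₂) 0 := hA₂.right_inv _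
  have hx : |max (-x₁) 0 - max (-x₂) 0| ≤ |x₁ - x₂| := by
    simpa only [neg_sub_neg, abs_sub_comm] using abs_max_sub_max_le_abs (-x₁) (-x₂) 0
  calc |entryTime B₁ x₁ - τ| = |B₁ (max (-x₁) 0) - B₁ (A₁ τ)| := by
        rw [entryTime, hA₁.left_inv]
    _ ≤ K * |max (-x₁) 0 - A₁ τ| := hA₁.lipschitz_inv.dist_le_mul _ _
    _ ≤ K * (|max (-x₁) 0 - max (-x₂) 0| + |A₂ τ - A₁ τ|) := by
        gcongr
        exact hτ ▸ abs_sub_le _ _ _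
    _ ≤ K * (|x₁ - x₂| + |A₁ τ - A₂ τ|) := by
        rw [abs_sub_comm (A₂ τ)]
        gcongr

lemma BoundedMeasurable.continuous_primitive {g : ℝ → ℝ} (hg : BoundedMeasurable M g) :
    Continuous fun x => ∫ s in (0 : ℝ)..x, g s :=
  intervalIntegral.continuous_primitive hg.intervalIntegrable 0

lemma BoundedMeasurable.abs_integral_sub_integral_le {g : ℝ → ℝ} (hg : BoundedMeasurable M g)
    (a₁ a₂ b₁ b₂ : ℝ) :
    |(∫ x in a₁..b₁, g x) - ∫ x in a₂..b₂, g x| ≤ M * |b₁ - b₂| + M * |a₁ - a₂| := by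
  rw [intervalIntegral.integral_interval_sub_interval_comm' (hg.intervalIntegrable _ _)
    (hg.intervalIntegrable _ _) (hg.intervalIntegrable _ _)]
  exact (abs_sub _ _).trans (add_le_add (hg.abs_integral_le _ _) (hg.abs_integral_le _ _))

lemma continuous_roadMass (hA : IncreasingBiLipschitz K A B) (hρ : BoundedMeasurable M ρ₀)
    (hu : BoundedMeasurable M u) : Continuous (roadMass ℓ ρ₀ u A B) := by
  have hAc := hA.lipschitz.continuous
  have hBc := hA.lipschitz_inv.continuous
  have hmass : roadMass ℓ ρ₀ u A B = fun t => (∫ x in (0 : ℝ)..max (ℓ - A t) 0, ρ₀ x)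
      + ((∫ s in (0 : ℝ)..t, u s) - ∫ s in (0 : ℝ)..B (max (-(ℓ - A t)) 0), u s) :=
    funext fun t => by
      rw [roadMass, entryTime, intervalIntegral.integral_interval_sub_left
        (hu.intervalIntegrable _ _) (hu.intervalIntegrable _ _)]
  rw [hmass]
  exact (hρ.continuous_primitive.comp (by fun_prop)).add
    (hu.continuous_primitive.sub (hu.continuous_primitive.comp (by fun_prop)))

lemma abs_roadMass_le (hA : IncreasingBiLipschitz K A B) (hA0 : A 0 = 0)
    (hρ : BoundedMeasurable M ρ₀) (hu : BoundedMeasurable M u) (hℓ : 0 ≤ ℓ) (ht : t ∈ Icc 0 T) :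
    |roadMass ℓ ρ₀ u A B t| ≤ M * ℓ + M * T := by
  have hM := hρ.bound_nonneg
  have hAt : 0 ≤ A t := hA0 ▸ hA.strictMono.monotone ht.1
  have hentry0 := entryTime_nonneg hA hA0 (ℓ - A t)
  have hentryt : entryTime B (ℓ - A t) ≤ t := entryTime_le hA hA0 ht.1 (by linarith)
  calc |roadMass ℓ ρ₀ u A B t|
      ≤ M * |max (ℓ - A t) 0 - 0| + M * |t - entryTime B (ℓ - A t)| :=
        (abs_add_le _ _).trans (add_le_add (hρ.abs_integral_le _ _) (hu.abs_integral_le _ _))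
    _ ≤ M * ℓ + M * T := by
        rw [sub_zero, abs_of_nonneg (le_max_right _ _), abs_of_nonneg (sub_nonneg.2 hentryt)]
        gcongr
        · exact max_le (sub_le_self _ hAt) hℓ
        · exact (sub_le_self _ hentry0).trans ht.2

lemma abs_roadMass_sub_le (hA₁ : IncreasingBiLipschitz K A₁ B₁)
    (hA₂ : IncreasingBiLipschitz K A₂ B₂) (hA₂0 : A₂ 0 = 0) (hρ : BoundedMeasurable M ρ₀)
    (hu : BoundedMeasurable M u) (hℓ : 0 ≤ ℓ) (ht : 0 ≤ t) {S : ℝ}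
    (hS : ∀ s ∈ Icc 0 t, |A₁ s - A₂ s| ≤ S) :
    |roadMass ℓ ρ₀ u A₁ B₁ t - roadMass ℓ ρ₀ u A₂ B₂ t| ≤ (M + M * (K * 2)) * S := by
  have hM := hρ.bound_nonneg
  have hpos : |(ℓ - A₁ t) - (ℓ - A₂ t)| ≤ S := by
    rw [sub_sub_sub_cancel_left, abs_sub_comm]
    exact hS t ⟨ht, le_rfl⟩
  have hentry : |entryTime B₁ (ℓ - A₁ t) - entryTime B₂ (ℓ - A₂ t)| ≤ K * (S + S) :=
    (abs_entryTime_sub_le hA₁ hA₂ _ _).trans (mul_le_mul_of_nonneg_left (add_le_add hpos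
      (hS _ ⟨entryTime_nonneg hA₂ hA₂0 _, entryTime_le hA₂ hA₂0 ht (by linarith)⟩)) K.2)
  rw [roadMass, roadMass, add_sub_add_comm]
  calc _ ≤ (M * |max (ℓ - A₁ t) 0 - max (ℓ - A₂ t) 0| + M * |(0 : ℝ) - 0|)
        + (M * |t - t| + M * |entryTime B₁ (ℓ - A₁ t) - entryTime B₂ (ℓ - A₂ t)|) :=
        (abs_add_le _ _).trans (add_le_add (hρ.abs_integral_sub_integral_le _ _ _ _)
          (hu.abs_integral_sub_integral_le _ _ _ _))
    _ ≤ (M * S + M * |(0 : ℝ) - 0|) + (M * |t - t| + M * (K * (S + S))) := by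
        gcongr
        exact (abs_max_sub_max_le_abs _ _ _).trans hpos
    _ = (M + M * (K * 2)) * S := by rw [sub_self, sub_self, abs_zero]; ring

lemma integral_entryData_eq_roadMass (hA : IncreasingBiLipschitz K A B) (hA0 : A 0 = 0)
    (hρ : BoundedMeasurable M ρ₀) (hu : BoundedMeasurable M u) (hℓ : 0 ≤ ℓ) (ht : 0 ≤ t) :
    ∫ x in -A t..ℓ - A t, entryData B ρ₀ u x = roadMass ℓ ρ₀ u A B t := by
  have hAt : 0 ≤ A t := hA0 ▸ hA.strictMono.monotone ht
  have hi := (boundedMeasurable_entryData hA hρ hu).intervalIntegrable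
  have hinflow : ∀ {s : ℝ}, 0 ≤ s → s ≤ A t →
      ∫ x in -A t..-s, entryData B ρ₀ u x = ∫ σ in B s..t, u σ := fun hs hst => by
    simpa only [mul_one, hA.left_inv] using
      integral_entryData_mul_of_nonpos hA ρ₀ u (fun _ => 1) hs hst
  rw [roadMass, entryTime, neg_sub]
  rcases le_total (A t) ℓ with hle | hle
  · have hinitial := integral_entryData_mul_of_nonneg B ρ₀ u (fun _ => 1) le_rfl
      (sub_nonneg.2 hle)
    have hinflow0 := hinflow le_rfl hAt
    simp only [mul_one, neg_zero] at hinitial hinflow0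
    rw [max_eq_left (sub_nonneg.2 hle), max_eq_right (sub_nonpos.2 hle), ← hinitial, ← hinflow0,
      add_comm, intervalIntegral.integral_add_adjacent_intervals (hi _ _) (hi _ _)]
  · rw [max_eq_right (sub_nonpos.2 hle), max_eq_left (sub_nonneg.2 hle),
      intervalIntegral.integral_same, zero_add, ← hinflow (sub_nonneg.2 hle) (sub_le_self _ hℓ),
      neg_sub]

end RoadMass

/-! ### The linear problem in `L^p` -/

/-- `g` represents the class of `f` up to `μ`-null sets by a function that is bounded by `M`
everywhere, and nonnegative everywhere if `f` is nonnegative almost everywhere. -/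
structure IsBoundedRepresentative (μ : Measure ℝ) (f : ℝ → ℝ) (M : ℝ) (g : ℝ → ℝ) : Prop extends
    BoundedMeasurable M g where
  ae_eq : f =ᵐ[μ] g
  nonneg : (∀ᵐ x ∂μ, 0 ≤ f x) → ∀ x, 0 ≤ g x

lemma IsBoundedRepresentative.mono {μ : Measure ℝ} {f g : ℝ → ℝ} {M M' : ℝ}
    (h : IsBoundedRepresentative μ f M g) (hM : M ≤ M') : IsBoundedRepresentative μ f M' g where
  measurable := h.measurable
  abs_le x := (h.abs_le x).trans hM
  ae_eq := h.ae_eq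
  nonneg := h.nonneg

lemma exists_isBoundedRepresentative {μ : Measure ℝ} {f : ℝ → ℝ} (hf : MemLp f ⊤ μ) :
    ∃ M g, IsBoundedRepresentative μ f M g := by
  have hfin : eLpNormEssSup f μ ≠ ⊤ := eLpNorm_exponent_top (f := f) (μ := μ) ▸ hf.2.ne
  set M : ℝ := (eLpNormEssSup f μ).toReal
  have hfM : ∀ᵐ x ∂μ, |f x| ≤ M := by
    filter_upwards [ae_le_eLpNormEssSup (f := f) (μ := μ)] with x hx
    rw [Real.enorm_eq_ofReal_abs] at hx
    exact (ENNReal.ofReal_le_iff_le_toReal hfin).1 hx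
  have hmem : ∀ᵐ x ∂μ, f x ∈ {y | |y| ≤ M ∧ ((∀ᵐ x ∂μ, 0 ≤ f x) → 0 ≤ y)} := by
    by_cases h0 : ∀ᵐ x ∂μ, 0 ≤ f x
    · filter_upwards [hfM, h0] with x hx hx0 using ⟨hx, fun _ => hx0⟩
    · filter_upwards [hfM] with x hx using ⟨hx, fun h => absurd h h0⟩
  obtain ⟨g, hg, hrange, hfg⟩ := hf.1.aemeasurable.exists_ae_eq_range_subset hmem
    ⟨0, abs_zero.trans_le ENNReal.toReal_nonneg, fun _ => le_rfl⟩
  exact ⟨M, g, ⟨hg, fun x => (hrange ⟨x, rfl⟩).1⟩, hfg, fun h x => (hrange ⟨x, rfl⟩).2 h⟩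

variable {T ℓ : ℝ} {p : ℝ≥0∞}

lemma WeakForm.congr (hT : 0 ≤ T) (hℓ : 0 ≤ ℓ) {c c' r r' : ℝ → ℝ → ℝ} {r₀ r₀' u u' : ℝ → ℝ}
    (h : WeakForm T ℓ c r₀ u r) (hc : ∀ t ∈ Icc 0 T, ∀ x ∈ Icc 0 ℓ, c' t x = c t x)
    (hr : ∀ t ∈ Icc 0 T, r' t =ᵐ[volume.restrict (Icc 0 ℓ)] r t)
    (hr₀ : r₀' =ᵐ[volume.restrict (Icc 0 ℓ)] r₀) (hu : u' =ᵐ[volume.restrict (Icc 0 T)] u) :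
    WeakForm T ℓ c' r₀' u' r' := by
  intro φ hφ
  refine Eq.trans ?_ (h φ hφ)
  congr 1
  · congr 1
    · refine intervalIntegral.integral_congr fun t ht => ?_
      rw [uIcc_of_le hT] at ht
      simp only [intervalIntegral_eq_integral_Icc hℓ]
      refine integral_congr_ae ?_
      filter_upwards [hr t ht, ae_restrict_mem measurableSet_Icc] with x hrx hx
      rw [hrx, hc t ht x hx]
    · simp only [intervalIntegral_eq_integral_Icc hℓ]
      exact integral_congr_ae (hr₀.mono fun x hx => congrArg (· * φ (0, x)) hx)
  · simp only [intervalIntegral_eq_integral_Icc hT]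
    exact integral_congr_ae (hu.mono fun t ht => congrArg (· * φ (t, 0)) ht)

/-- `q` is an essentially bounded weak solution in `C([0, T]; L^p)` of the conservation law with
speed `c`, initial datum `q₀` and inflow `u`, and it is nonnegative if these data are. -/
structure IsBoundedSolution [Fact (1 ≤ p)] (T ℓ : ℝ) (c : ℝ → ℝ → ℝ) (q₀ u : ℝ → ℝ)
    (q : ℝ → RoadLp ℓ p) : Prop where
  continuousOn : ContinuousOn q (Icc 0 T)
  satisfiesWeakly : SatisfiesWeakly T ℓ c q₀ u q
  isEssBounded : IsEssBounded T ℓ q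
  nonneg : (∀ᵐ x ∂(volume.restrict (Icc 0 ℓ)), 0 ≤ q₀ x) →
    (∀ᵐ t ∂(volume.restrict (Icc 0 T)), 0 ≤ u t) → ∀ t, 0 ≤ q t

section Existence

variable [Fact (1 ≤ p)] {c : ℝ → ℝ → ℝ} {q₀ u : ℝ → ℝ}

lemma IsBoundedSolution.congr (hT : 0 ≤ T) (hℓ : 0 ≤ ℓ) {c' : ℝ → ℝ → ℝ} {q : ℝ → RoadLp ℓ p}
    (h : IsBoundedSolution T ℓ c q₀ u q) (hc : ∀ t ∈ Icc 0 T, ∀ x ∈ Icc 0 ℓ, c' t x = c t x) :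
    IsBoundedSolution T ℓ c' q₀ u q where
  continuousOn := h.continuousOn
  satisfiesWeakly := WeakForm.congr hT hℓ h.satisfiesWeakly hc (fun _ _ => .rfl) .rfl .rfl
  isEssBounded := h.isEssBounded
  nonneg := h.nonneg

theorem IsFlow.exists_isBoundedSolution (hp : p ≠ ⊤) (hT : 0 ≤ T) (hℓ : 0 ≤ ℓ)
    {L : ℝ≥0} {cmin cmax M : ℝ} {g w : ℝ → ℝ} {Z : ℝ → ℝ → ℝ → ℝ} (hZ : IsFlow c Z)
    (h : IsSpeed c L cmin cmax) (hc : ∀ t, ∀ x ≤ 0, c t x = c t 0)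
    (hg : IsBoundedRepresentative (volume.restrict (Icc 0 ℓ)) q₀ M g)
    (hw : IsBoundedRepresentative (volume.restrict (Icc 0 T)) u M w) :
    ∃ q : ℝ → RoadLp ℓ p, IsBoundedSolution T ℓ c q₀ u q ∧
      ∀ t, q t =ᵐ[volume.restrict (Icc 0 ℓ)]
        transported Z (entryData (arrival fun t => c t 0) g w) t := by
  have hA := (h.comp (continuous_const (y := (0 : ℝ)))).increasingBiLipschitz_travel
  have hm := boundedMeasurable_entryData hA hg.toBoundedMeasurable hw.toBoundedMeasurable
  set r := transported Z (entryData (arrival fun t => c t 0) g w)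
  have hr : ∀ t, MemLp (r t) p (volume.restrict (Icc 0 ℓ)) := fun t =>
    (hZ.boundedMeasurable_transported h hm t).memLp
  obtain ⟨N, hN⟩ : ∃ N, ∀ t ∈ Icc 0 T, ∀ x, |r t x| ≤ N := by
    refine ⟨_ * Real.exp (L * T), fun t ht x =>
      ((hZ.boundedMeasurable_transported h hm t).abs_le x).trans
        (mul_le_mul_of_nonneg_left ?_ hm.bound_nonneg)⟩
    rw [coe_flowConst, zero_sub, abs_neg, abs_of_nonneg ht.1]
    gcongr
    exact ht.2
  have hqr : ∀ t, (hr t).toLp (r t) =ᵐ[volume.restrict (Icc 0 ℓ)] r t := fun t =>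
    MemLp.coeFn_toLp (hr t)
  refine ⟨fun t => (hr t).toLp (r t), ⟨?_, ?_, ⟨N, fun t ht => ?_⟩, fun hq₀ hu t => ?_⟩, hqr⟩
  · exact (hZ.continuousInL1On_transported h hℓ hm _).continuousOn_toLp hp hℓ hr hN
  · exact (hZ.weakForm_transported h hA (fun t ht => hZ.apply_zero_eq_neg_travel h hc ht) hT hℓ
      hg.toBoundedMeasurable hw.toBoundedMeasurable).congr hT hℓ (fun _ _ _ _ => rfl)
      (fun t _ => hqr t) hg.ae_eq hw.ae_eq
  · exact (hqr t).mono fun x hx => hx ▸ hN t ht x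
  · exact (Lp.coeFn_nonneg _).1 ((hqr t).mono fun x hx => hx ▸
      hZ.transported_nonneg h (entryData_nonneg hA (hg.nonneg hq₀) (hw.nonneg hu)) t x)

end Existence

section Clamp

variable {α β : ℝ} {c : ℝ → ℝ → ℝ}

/-- The extension to the plane of a speed field given on `[0, T] × [α, β]`, constant along the
coordinate directions outside of this rectangle. -/
noncomputable def clampedSpeed (hT : 0 ≤ T) (hαβ : α ≤ β) (c : ℝ → ℝ → ℝ) (t x : ℝ) : ℝ :=
  c (projIcc 0 T hT t) (projIcc α β hαβ x)

lemma clampedSpeed_of_mem (hT : 0 ≤ T) (hαβ : α ≤ β) (c : ℝ → ℝ → ℝ) {t x : ℝ}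
    (ht : t ∈ Icc 0 T) (hx : x ∈ Icc α β) : clampedSpeed hT hαβ c t x = c t x := by
  rw [clampedSpeed, projIcc_of_mem hT ht, projIcc_of_mem hαβ hx]

lemma clampedSpeed_of_le_left (hT : 0 ≤ T) (hαβ : α ≤ β) (c : ℝ → ℝ → ℝ) (t : ℝ) {x : ℝ}
    (hx : x ≤ α) : clampedSpeed hT hαβ c t x = clampedSpeed hT hαβ c t α := by
  rw [clampedSpeed, clampedSpeed, projIcc_of_le_left hαβ hx, projIcc_of_le_left hαβ le_rfl]

lemma exists_isSpeed_clampedSpeed (hT : 0 ≤ T) (hαβ : α ≤ β)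
    (hc : ContinuousOn (fun z : ℝ × ℝ => c z.1 z.2) (Icc 0 T ×ˢ Icc α β))
    (hpos : ∀ t ∈ Icc 0 T, ∀ x ∈ Icc α β, 0 < c t x) {K : ℝ≥0}
    (hlip : ∀ t ∈ Icc 0 T, LipschitzOnWith K (c t) (Icc α β)) :
    ∃ cmin cmax, IsSpeed (clampedSpeed hT hαβ c) K cmin cmax := by
  have hcompact : IsCompact (Icc 0 T ×ˢ Icc α β) := isCompact_Icc.prod isCompact_Icc
  obtain ⟨cmin, hcmin, hmin⟩ := hcompact.exists_forall_le' hc fun z hz => hpos z.1 hz.1 z.2 hz.2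
  obtain ⟨cmax, hmax⟩ := hcompact.bddAbove_image hc
  have hmem : ∀ t x, ((projIcc 0 T hT t : ℝ), (projIcc α β hαβ x : ℝ)) ∈ Icc 0 T ×ˢ Icc α β :=
    fun t x => ⟨Subtype.coe_prop _, Subtype.coe_prop _⟩
  refine ⟨cmin, cmax, ?_, fun t => ?_, hcmin, fun t x => hmin _ (hmem t x),
    fun t x => hmax (mem_image_of_mem _ (hmem t x))⟩
  · exact hc.comp_continuous
      (f := fun z : ℝ × ℝ => ((projIcc 0 T hT z.1 : ℝ), (projIcc α β hαβ z.2 : ℝ)))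
      (by fun_prop) fun z => hmem z.1 z.2
  · have hproj : LipschitzWith 1 fun x => (projIcc α β hαβ x : ℝ) := LipschitzWith.projIcc hαβ
    have hcomp := (hlip _ (hmem t α).1).comp hproj.lipschitzOnWith
      (fun x _ => (hmem t x).2 : MapsTo _ univ _)
    rwa [mul_one, lipschitzOnWith_univ] at hcomp

end Clamp

theorem eqOn_of_satisfiesWeakly [Fact (1 ≤ p)] (hT : 0 < T) (hℓ : 0 < ℓ)
    {c₁ c₂ : ℝ → ℝ → ℝ} {r₀ u : ℝ → ℝ} {r₁ r₂ : ℝ → RoadLp ℓ p}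
    (hr₁ : ContinuousOn r₁ (Icc 0 T)) (hr₂ : ContinuousOn r₂ (Icc 0 T))
    (hc₁ : ContinuousOn (fun z : ℝ × ℝ => c₁ z.1 z.2) (Icc 0 T ×ˢ Icc 0 ℓ))
    (hc₂ : ContinuousOn (fun z : ℝ × ℝ => c₂ z.1 z.2) (Icc 0 T ×ˢ Icc 0 ℓ))
    (h₁ : SatisfiesWeakly T ℓ c₁ r₀ u r₁) (h₂ : SatisfiesWeakly T ℓ c₂ r₀ u r₂)
    {K : ℝ≥0} (hlip : ∀ t ∈ Icc 0 T, LipschitzOnWith K (c₁ t) (Icc 0 ℓ))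
    (hpos : ∀ t ∈ Icc 0 T, 0 < c₁ t ℓ) (hbdd : IsEssBounded T ℓ r₂) {K' : ℝ}
    (hdiff : ∀ t ∈ Icc 0 T, ∀ x ∈ Icc 0 ℓ, |c₁ t x - c₂ t x|
      ≤ K' * |(∫ y in (0 : ℝ)..ℓ, r₁ t y) - ∫ y in (0 : ℝ)..ℓ, r₂ t y|) :
    EqOn r₁ r₂ (Icc 0 T) := by
  have hr₁' := continuousInL1On_of_continuousOn_Lp hℓ.le hr₁
  have hr₂' := continuousInL1On_of_continuousOn_Lp hℓ.le hr₂
  obtain ⟨M, hM⟩ := hbdd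
  obtain ⟨cmin, hcmin, hmin⟩ := isCompact_Icc.exists_forall_le'
    (hc₁.comp (f := fun t => (t, ℓ)) (by fun_prop) fun t ht => ⟨ht, right_mem_Icc.2 hℓ.le⟩) hpos
  refine fun t ht => Lp.ext (WeakForm.ae_eq hT hℓ hr₁' hr₂' hc₁ hc₂ h₁ h₂ hlip hcmin hmin hM
    (K' := K') (fun t ht x hx => ?_) ht)
  rw [intervalIntegral.integral_sub (hr₁'.intervalIntegrable ht) (hr₂'.intervalIntegrable ht)]
  exact hdiff t ht x hx

theorem exists_unique_isBoundedSolution [Fact (1 ≤ p)] (hp : p ≠ ⊤) (hT : 0 < T) (hℓ : 0 < ℓ)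
    {c : ℝ → ℝ → ℝ} {q₀ u : ℝ → ℝ}
    (hc : ContinuousOn (fun z : ℝ × ℝ => c z.1 z.2) (Icc 0 T ×ˢ Icc 0 ℓ))
    (hpos : ∀ t ∈ Icc 0 T, ∀ x ∈ Icc 0 ℓ, 0 < c t x) {K : ℝ≥0}
    (hlip : ∀ t ∈ Icc 0 T, LipschitzOnWith K (c t) (Icc 0 ℓ))
    (hq₀ : MemLp q₀ ⊤ (volume.restrict (Icc 0 ℓ))) (hu : MemLp u ⊤ (volume.restrict (Icc 0 T))) :
    ∃ q : ℝ → RoadLp ℓ p, IsBoundedSolution T ℓ c q₀ u q ∧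
      ∀ q' : ℝ → RoadLp ℓ p, ContinuousOn q' (Icc 0 T) → SatisfiesWeakly T ℓ c q₀ u q' →
        EqOn q' q (Icc 0 T) := by
  obtain ⟨M, g, hg⟩ := exists_isBoundedRepresentative hq₀
  obtain ⟨N, w, hw⟩ := exists_isBoundedRepresentative hu
  obtain ⟨cmin, cmax, hspeed⟩ := exists_isSpeed_clampedSpeed hT.le hℓ.le hc hpos hlip
  obtain ⟨Z, hZ⟩ := hspeed.exists_flow
  obtain ⟨q, hq, -⟩ := hZ.exists_isBoundedSolution (p := p) hp hT.le hℓ.le hspeed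
    (fun t _ hx => clampedSpeed_of_le_left hT.le hℓ.le c t hx) (hg.mono (le_max_left M N))
    (hw.mono (le_max_right M N))
  have hq' := hq.congr hT.le hℓ.le fun t ht x hx =>
    (clampedSpeed_of_mem hT.le hℓ.le c ht hx).symm
  exact ⟨q, hq', fun r hr hw => eqOn_of_satisfiesWeakly hT hℓ hr hq'.continuousOn hc hc hw
    hq'.satisfiesWeakly hlip (fun t ht => hpos t ht ℓ (right_mem_Icc.2 hℓ.le)) hq'.isEssBounded
    (K' := 0) fun t _ x _ => by rw [sub_self, abs_zero, zero_mul]⟩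

/-! ### The background traffic -/

section Traffic

lemma abs_travel_sub_le {a₁ a₂ : ℝ → ℝ} (h₁ : Continuous a₁) (h₂ : Continuous a₂) {s t : ℝ}
    (hs : s ∈ Icc 0 t) : |travel a₁ s - travel a₂ s| ≤ ∫ σ in (0 : ℝ)..t, |a₁ σ - a₂ σ| := by
  rw [travel, travel, ← intervalIntegral.integral_sub (h₁.intervalIntegrable _ _)
    (h₂.intervalIntegrable _ _)]
  exact (intervalIntegral.abs_integral_le_integral_abs hs.1).trans
    (intervalIntegral.integral_mono_interval le_rfl hs.1 hs.2 (ae_of_all _ fun _ => abs_nonneg _)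
      ((h₁.sub h₂).abs.intervalIntegrable _ _))

variable {T ℓ M : ℝ} {K : ℝ≥0} {ρ₀ u : ℝ → ℝ}

theorem IsSpeed.exists_eq_roadMass {V : ℝ → ℝ → ℝ} {vmin vmax : ℝ} (h : IsSpeed V K vmin vmax)
    (hT : 0 ≤ T) (hℓ : 0 ≤ ℓ) (hρ : BoundedMeasurable M ρ₀) (hu : BoundedMeasurable M u) :
    ∃ m : ℝ → ℝ, Continuous m ∧ ∀ t ∈ Icc 0 T,
      m t = roadMass ℓ ρ₀ u (travel fun t => V t (m t)) (arrival fun t => V t (m t)) t := by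
  have hA : ∀ {m : ℝ → ℝ}, Continuous m → IncreasingBiLipschitz (biLipschitzConst vmin vmax)
      (travel fun t => V t (m t)) (arrival fun t => V t (m t)) := fun hm =>
    (h.comp hm).increasingBiLipschitz_travel
  have hV : ∀ {m : ℝ → ℝ}, Continuous m → Continuous fun t => V t (m t) := fun hm =>
    h.continuous.comp (continuous_id.prodMk hm)
  have hC : 0 ≤ M + M * (biLipschitzConst vmin vmax * 2) := by
    have := hρ.bound_nonneg
    positivity
  refine exists_fixedPoint_volterra hT
    (G := fun m => roadMass ℓ ρ₀ u (travel fun t => V t (m t)) (arrival fun t => V t (m t)))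
    (fun m hm => continuous_roadMass (hA hm) hρ hu) (mul_nonneg hC K.2)
    fun m₁ m₂ h₁ h₂ t ht => ?_
  have hspeeds : ∫ s in (0 : ℝ)..t, |V s (m₁ s) - V s (m₂ s)|
      ≤ K * ∫ s in (0 : ℝ)..t, ‖m₁ s - m₂ s‖ := by
    rw [← intervalIntegral.integral_const_mul]
    exact intervalIntegral.integral_mono_on ht.1
      (((hV h₁).sub (hV h₂)).abs.intervalIntegrable _ _)
      ((continuous_const.mul (h₁.sub h₂).norm).intervalIntegrable _ _)
      fun s _ => (h.lipschitz s).dist_le_mul (m₁ s) (m₂ s)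
  rw [mul_assoc]
  exact (abs_roadMass_sub_le (hA h₁) (hA h₂) (travel_zero _) hρ hu hℓ ht.1
    fun s hs => abs_travel_sub_le (hV h₁) (hV h₂) hs).trans (mul_le_mul_of_nonneg_left hspeeds hC)

lemma IsFlow.integral_transported_eq_roadMass {a : ℝ → ℝ} {amin amax : ℝ} {Z : ℝ → ℝ → ℝ → ℝ}
    (hZ : IsFlow (fun t _ => a t) Z) (h : IsSpeed (fun t _ => a t) K amin amax) (hℓ : 0 ≤ ℓ)
    (hρ : BoundedMeasurable M ρ₀) (hu : BoundedMeasurable M u) {t : ℝ} (ht : 0 ≤ t) :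
    ∫ x in (0 : ℝ)..ℓ, transported Z (entryData (arrival a) ρ₀ u) t x
      = roadMass ℓ ρ₀ u (travel a) (arrival a) t := by
  have hback : ∀ x, Z 0 t x = x - travel a t := hZ.eq_sub_integral h 0 t
  rw [hZ.integral_transported h, hback, hback, zero_sub]
  exact integral_entryData_eq_roadMass h.increasingBiLipschitz_travel (travel_zero a) hρ hu hℓ ht

variable {v : ℝ → ℝ → ℝ} {p : ℝ≥0∞} [Fact (1 ≤ p)]

theorem exists_isBoundedSolution_traffic (hp : p ≠ ⊤) (hT : 0 ≤ T) (hℓ : 0 ≤ ℓ)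
    (hv : ContinuousOn (fun z : ℝ × ℝ => v z.1 z.2) (Icc 0 T ×ˢ univ))
    (hpos : ∀ t ∈ Icc 0 T, ∀ y, 0 < v t y)
    (hlip : ∀ R, ∃ K : ℝ≥0, ∀ t ∈ Icc 0 T, LipschitzOnWith K (v t) (Icc (-R) R))
    (hρ₀ : MemLp ρ₀ ⊤ (volume.restrict (Icc 0 ℓ))) (hu : MemLp u ⊤ (volume.restrict (Icc 0 T))) :
    ∃ ρ : ℝ → RoadLp ℓ p,
      IsBoundedSolution T ℓ (fun t _ => v t (∫ s in (0 : ℝ)..ℓ, ρ t s)) ρ₀ u ρ := by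
  obtain ⟨M₁, g, hg⟩ := exists_isBoundedRepresentative hρ₀
  obtain ⟨M₂, w, hw⟩ := exists_isBoundedRepresentative hu
  replace hg := hg.mono (le_max_left M₁ M₂)
  replace hw := hw.mono (le_max_right M₁ M₂)
  set M := max M₁ M₂
  -- no solution can carry more mass than `R`, so only the restriction of `v` to `[-R, R]` matters
  set R := M * ℓ + M * T
  have hR : -R ≤ R := by
    have := hg.bound_nonneg
    exact neg_le_self (by positivity)
  obtain ⟨K, hK⟩ := hlip R
  obtain ⟨vmin, vmax, hspeed⟩ := exists_isSpeed_clampedSpeed hT hR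
    (hv.mono (prod_mono_right (subset_univ _))) (fun t ht y _ => hpos t ht y) hK
  obtain ⟨m, hm, hfix⟩ :=
    hspeed.exists_eq_roadMass hT hℓ hg.toBoundedMeasurable hw.toBoundedMeasurable
  have ha := hspeed.comp hm
  obtain ⟨Z, hZ⟩ := ha.exists_flow
  obtain ⟨ρ, hρ, hρZ⟩ := hZ.exists_isBoundedSolution hp hT hℓ ha (fun _ _ _ => rfl) hg hw
  refine ⟨ρ, hρ.congr hT hℓ fun t ht _ _ => ?_⟩
  have hmass : ∫ s in (0 : ℝ)..ℓ, ρ t s = m t := by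
    rw [hfix t ht, ← hZ.integral_transported_eq_roadMass ha hℓ hg.toBoundedMeasurable
      hw.toBoundedMeasurable ht.1]
    simp only [intervalIntegral_eq_integral_Icc hℓ]
    exact integral_congr_ae (hρZ t)
  have hmR : m t ∈ Icc (-R) R := by
    rw [hfix t ht]
    exact abs_le.1 (abs_roadMass_le ha.increasingBiLipschitz_travel (travel_zero _)
      hg.toBoundedMeasurable hw.toBoundedMeasurable hℓ ht)
  rw [hmass, clampedSpeed_of_mem hT hR v ht hmR]

theorem eqOn_of_satisfiesWeakly_traffic (hT : 0 < T) (hℓ : 0 < ℓ)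
    (hv : ContinuousOn (fun z : ℝ × ℝ => v z.1 z.2) (Icc 0 T ×ˢ univ))
    (hpos : ∀ t ∈ Icc 0 T, ∀ y, 0 < v t y)
    (hlip : ∀ R, ∃ K : ℝ≥0, ∀ t ∈ Icc 0 T, LipschitzOnWith K (v t) (Icc (-R) R))
    {ρ₁ ρ₂ : ℝ → RoadLp ℓ p} (hρ₁ : ContinuousOn ρ₁ (Icc 0 T)) (hρ₂ : ContinuousOn ρ₂ (Icc 0 T))
    (h₁ : SatisfiesWeakly T ℓ (fun t _ => v t (∫ s in (0 : ℝ)..ℓ, ρ₁ t s)) ρ₀ u ρ₁)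
    (h₂ : SatisfiesWeakly T ℓ (fun t _ => v t (∫ s in (0 : ℝ)..ℓ, ρ₂ t s)) ρ₀ u ρ₂)
    (hbdd : IsEssBounded T ℓ ρ₂) : EqOn ρ₁ ρ₂ (Icc 0 T) := by
  have hm₁ := (continuousInL1On_of_continuousOn_Lp hℓ.le hρ₁).continuousOn_integral hℓ.le
  have hm₂ := (continuousInL1On_of_continuousOn_Lp hℓ.le hρ₂).continuousOn_integral hℓ.le
  obtain ⟨R₁, hR₁⟩ := isCompact_Icc.exists_bound_of_continuousOn hm₁
  obtain ⟨R₂, hR₂⟩ := isCompact_Icc.exists_bound_of_continuousOn hm₂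
  obtain ⟨K, hK⟩ := hlip (max R₁ R₂)
  have hc : ∀ {m : ℝ → ℝ}, ContinuousOn m (Icc 0 T) →
      ContinuousOn (fun z : ℝ × ℝ => v z.1 (m z.1)) (Icc 0 T ×ˢ Icc 0 ℓ) := fun hm =>
    hv.comp (continuousOn_fst.prodMk (hm.comp continuousOn_fst fun z hz => hz.1))
      fun z hz => ⟨hz.1, mem_univ _⟩
  exact eqOn_of_satisfiesWeakly hT hℓ hρ₁ hρ₂ (hc hm₁) (hc hm₂) h₁ h₂
    (fun t _ => (LipschitzWith.const _).lipschitzOnWith) (fun t ht => hpos t ht _) hbdd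
    fun t ht x _ => (hK t ht).dist_le_mul _ (abs_le.1 ((hR₁ t ht).trans (le_max_left _ _)))
      _ (abs_le.1 ((hR₂ t ht).trans (le_max_right _ _)))

end Traffic

/-! ### The trucks -/

section Trucks

lemma ContinuousInL1On.continuousOn_integral_of_mapsTo {S X : Set ℝ} {α β : ℝ} {r : ℝ → ℝ → ℝ}
    (hr : ContinuousInL1On S α β r) (hαβ : α ≤ β) {b d : ℝ → ℝ} (hb : ContinuousOn b X)
    (hd : ContinuousOn d X) (hb_maps : MapsTo b X (Icc α β)) (hd_maps : MapsTo d X (Icc α β)) :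
    ContinuousOn (fun z : ℝ × ℝ => ∫ s in b z.2..d z.2, r z.1 s) (S ×ˢ X) := by
  have hprim : ∀ {e : ℝ → ℝ}, ContinuousOn e X → MapsTo e X (Icc α β) →
      ContinuousOn (fun z : ℝ × ℝ => ∫ s in α..e z.2, r z.1 s) (S ×ˢ X) := fun he hmaps =>
    (hr.continuousOn_primitive hαβ).comp
      (continuousOn_fst.prodMk (he.comp continuousOn_snd fun z hz => hz.2))
      fun z hz => ⟨hz.1, hmaps hz.2⟩
  refine ((hprim hd hd_maps).sub (hprim hb hb_maps)).congr fun z hz => ?_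
  have hint : ∀ {y}, y ∈ Icc α β → IntervalIntegrable (r z.1) volume α y := fun hy =>
    (hr.intervalIntegrable hz.1).mono_set (by
      rw [uIcc_of_le hαβ, uIcc_of_le hy.1]
      exact Icc_subset_Icc_right hy.2)
  exact (intervalIntegral.integral_interval_sub_left (hint (hd_maps hz.2))
    (hint (hb_maps hz.2))).symm

lemma lipschitzOnWith_integral {X : Set ℝ} {α β : ℝ} {f : ℝ → ℝ}
    (hαβ : α ≤ β) (hf : IntervalIntegrable f volume α β) {M : ℝ≥0}
    (hM : ∀ᵐ x ∂(volume.restrict (Icc α β)), |f x| ≤ M) {b d : ℝ → ℝ} {Kb Kd : ℝ≥0}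
    (hb : LipschitzOnWith Kb b X) (hd : LipschitzOnWith Kd d X)
    (hb_maps : MapsTo b X (Icc α β)) (hd_maps : MapsTo d X (Icc α β)) :
    LipschitzOnWith (M * (Kd + Kb)) (fun x => ∫ s in b x..d x, f s) X := by
  have hint : ∀ {x y}, x ∈ Icc α β → y ∈ Icc α β → IntervalIntegrable f volume x y :=
    fun hx hy => hf.mono_set ((uIcc_subset_Icc hx hy).trans_eq (uIcc_of_le hαβ).symm)
  have hbound : ∀ {x y}, x ∈ Icc α β → y ∈ Icc α β → |∫ s in x..y, f s| ≤ M * |y - x| := by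
    intro x y hx hy
    refine intervalIntegral.norm_integral_le_of_norm_le_const_ae (f := f) ?_
    filter_upwards [(ae_restrict_iff' measurableSet_Icc).1 hM] with s hs hsxy
    exact hs (uIcc_subset_Icc hx hy (uIoc_subset_uIcc hsxy))
  refine LipschitzOnWith.of_dist_le_mul fun x hx y hy => ?_
  have hbx := hb_maps hx
  have hby := hb_maps hy
  have hdx := hd_maps hx
  have hdy := hd_maps hy
  calc |(∫ s in b x..d x, f s) - ∫ s in b y..d y, f s|
      = |(∫ s in d y..d x, f s) - ∫ s in b y..b x, f s| := by
        rw [intervalIntegral.integral_interval_sub_interval_comm' (hint hbx hdx) (hint hby hdy)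
          (hint hbx hby)]
    _ ≤ M * |d x - d y| + M * |b x - b y| :=
        (abs_sub _ _).trans (add_le_add (hbound hdy hdx) (hbound hby hbx))
    _ ≤ M * (Kd * dist x y) + M * (Kb * dist x y) := by
        gcongr
        · exact hd.dist_le_mul x hx y hy
        · exact hb.dist_le_mul x hx y hy
    _ = ↑(M * (Kd + Kb)) * dist x y := by push_cast; ring

variable {T ℓ : ℝ} {lam : ℝ → ℝ → ℝ → ℝ} {N : ℝ → ℝ → ℝ}

lemma exists_lipschitzOnWith_truckSpeed
    (hlip : ∀ R, ∃ K : ℝ≥0, ∀ t ∈ Icc 0 T,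
      LipschitzOnWith K (fun z : ℝ × ℝ => lam t z.1 z.2) (Icc 0 ℓ ×ˢ Icc 0 R))
    (hN : ContinuousOn (fun z : ℝ × ℝ => N z.1 z.2) (Icc 0 T ×ˢ Icc 0 ℓ))
    (hN_nonneg : ∀ t ∈ Icc 0 T, ∀ x ∈ Icc 0 ℓ, 0 ≤ N t x) {K : ℝ≥0}
    (hN_lip : ∀ t ∈ Icc 0 T, LipschitzOnWith K (N t) (Icc 0 ℓ)) :
    ∃ K' : ℝ≥0, ∀ t ∈ Icc 0 T, LipschitzOnWith K' (fun x => lam t x (N t x)) (Icc 0 ℓ) := by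
  obtain ⟨R, hR⟩ := (isCompact_Icc.prod isCompact_Icc).bddAbove_image hN
  obtain ⟨K', hK'⟩ := hlip R
  exact ⟨_, fun t ht => (hK' t ht).comp (LipschitzWith.id.lipschitzOnWith.prodMk (hN_lip t ht))
    fun x hx => ⟨hx, hN_nonneg t ht x hx, hR (mem_image_of_mem _ (mk_mem_prod ht hx))⟩⟩

theorem exists_unique_isBoundedSolution_truck {p : ℝ≥0∞} [Fact (1 ≤ p)] (hp : p ≠ ⊤) (hT : 0 < T)
    (hℓ : 0 < ℓ)
    (hlam : ContinuousOn (fun z : ℝ × ℝ × ℝ => lam z.1 z.2.1 z.2.2)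
      (Icc 0 T ×ˢ (Icc 0 ℓ ×ˢ Ici 0)))
    (hpos : ∀ t ∈ Icc 0 T, ∀ x ∈ Icc 0 ℓ, ∀ y ∈ Ici 0, 0 < lam t x y)
    (hlip : ∀ R, ∃ K : ℝ≥0, ∀ t ∈ Icc 0 T,
      LipschitzOnWith K (fun z : ℝ × ℝ => lam t z.1 z.2) (Icc 0 ℓ ×ˢ Icc 0 R))
    {b d : ℝ → ℝ} {Kb Kd : ℝ≥0} (hb : LipschitzOnWith Kb b (Icc 0 ℓ))
    (hd : LipschitzOnWith Kd d (Icc 0 ℓ)) (hb_maps : MapsTo b (Icc 0 ℓ) (Icc 0 ℓ))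
    (hd_maps : MapsTo d (Icc 0 ℓ) (Icc 0 ℓ)) (hbd : ∀ x ∈ Icc 0 ℓ, b x ≤ d x)
    {ρ : ℝ → RoadLp ℓ p} (hρ : ContinuousOn ρ (Icc 0 T)) (hρ_nonneg : ∀ t ∈ Icc 0 T, 0 ≤ ρ t)
    (hρ_bdd : IsEssBounded T ℓ ρ) {q₀ u : ℝ → ℝ}
    (hq₀ : MemLp q₀ ⊤ (volume.restrict (Icc 0 ℓ))) (hu : MemLp u ⊤ (volume.restrict (Icc 0 T))) :
    ∃ q : ℝ → RoadLp ℓ p,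
      IsBoundedSolution T ℓ (fun t x => lam t x (∫ s in (b x)..(d x), ρ t s)) q₀ u q ∧
      ∀ q' : ℝ → RoadLp ℓ p, ContinuousOn q' (Icc 0 T) →
        SatisfiesWeakly T ℓ (fun t x => lam t x (∫ s in (b x)..(d x), ρ t s)) q₀ u q' →
        EqOn q' q (Icc 0 T) := by
  have hρ' := continuousInL1On_of_continuousOn_Lp hℓ.le hρ
  have hN := hρ'.continuousOn_integral_of_mapsTo hℓ.le hb.continuousOn hd.continuousOn
    hb_maps hd_maps
  have hN_nonneg : ∀ t ∈ Icc 0 T, ∀ x ∈ Icc 0 ℓ, 0 ≤ ∫ s in (b x)..(d x), ρ t s :=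
    fun t ht x hx => intervalIntegral.integral_nonneg_of_ae_restrict (hbd x hx)
      (ae_restrict_of_ae_restrict_of_subset (Icc_subset_Icc (hb_maps hx).1 (hd_maps hx).2)
        ((Lp.coeFn_nonneg _).2 (hρ_nonneg t ht)))
  obtain ⟨M, hM⟩ := hρ_bdd
  obtain ⟨K, hK⟩ := exists_lipschitzOnWith_truckSpeed hlip hN hN_nonneg fun t ht =>
    lipschitzOnWith_integral hℓ.le (hρ'.intervalIntegrable ht)
      ((hM t ht).mono fun x hx => hx.trans (Real.le_coe_toNNReal M)) hb hd hb_maps hd_maps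
  exact exists_unique_isBoundedSolution hp hT hℓ
    (hlam.comp (continuousOn_fst.prodMk (continuousOn_snd.prodMk hN))
      fun z hz => ⟨hz.1, hz.2, hN_nonneg z.1 hz.1 z.2 hz.2⟩)
    (fun t ht x hx => hpos t ht x hx _ (hN_nonneg t ht x hx)) hK hq₀ hu

lemma lipschitzOnWith_of_mem_admissibleSpeeds {lmin lmax L : ℝ}
    (hlam : lam ∈ admissibleSpeeds T ℓ lmin lmax L) (hL : 0 ≤ L) {t : ℝ} (ht : t ∈ Icc 0 T) :
    LipschitzOnWith (2 * L).toNNReal (fun z : ℝ × ℝ => lam t z.1 z.2) (Icc 0 ℓ ×ˢ Ici 0) := by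
  obtain ⟨hcont, -, hlip⟩ := hlam
  have hclosure : closure (Icc 0 ℓ ×ˢ Ioi 0) = Icc 0 ℓ ×ˢ Ici (0 : ℝ) := by
    rw [closure_prod_eq, isClosed_Icc.closure_eq, closure_Ioi]
  have hopen : LipschitzOnWith (2 * L).toNNReal (fun z : ℝ × ℝ => lam t z.1 z.2)
      (Icc 0 ℓ ×ˢ Ioi 0) := LipschitzOnWith.of_dist_le_mul fun z hz z' hz' => by
    calc |lam t z.1 z.2 - lam t z'.1 z'.2|
        ≤ L * (dist z.1 z'.1 + dist z.2 z'.2 + |t - t|) :=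
          hlip t ht t ht _ hz.1 _ hz'.1 _ hz.2 _ hz'.2
      _ ≤ L * (dist z z' + dist z z' + 0) := by
          rw [sub_self, abs_zero]
          gcongr
          · exact le_max_left _ _
          · exact le_max_right _ _
      _ = (2 * L).toNNReal * dist z z' := by
          rw [Real.coe_toNNReal _ (by positivity)]
          ring
  rw [← hclosure]
  exact hopen.closure (hclosure ▸ hcont.comp (f := fun z : ℝ × ℝ => (t, z)) (by fun_prop)
    fun z hz => ⟨ht, hz⟩)

end Trucks

lemma exists_lipschitzOnWith_right_of_contDiffOn {E F G : Type*} [NormedAddCommGroup E]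
    [NormedSpace ℝ E] [NormedAddCommGroup F] [NormedSpace ℝ F] [NormedAddCommGroup G]
    [NormedSpace ℝ G] {f : E × F → G} {s : Set E} {t : Set F} (hf : ContDiffOn ℝ 1 f (s ×ˢ t))
    (hs : Convex ℝ s) (hs' : IsCompact s) (ht : Convex ℝ t) (ht' : IsCompact t) :
    ∃ K : ℝ≥0, ∀ x ∈ s, LipschitzOnWith K (fun y => f (x, y)) t := by
  obtain ⟨K, hK⟩ := hf.exists_lipschitzOnWith one_ne_zero (hs.prod ht) (hs'.prod ht')
  refine ⟨K, fun x hx => ?_⟩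
  simpa only [mul_one, Function.comp_def] using
    hK.comp (LipschitzWith.prodMk_left x).lipschitzOnWith fun y hy => mk_mem_prod hx hy

end RoadTraffic

theorem mainTheorem5_general
    (T ℓ : ℝ) (hT : 0 < T) (hℓ : 0 < ℓ)
    (p : ℝ≥0∞) [Fact (1 ≤ p)] (hp : p ≠ ⊤)
    (v : ℝ → ℝ → ℝ)
    (hv : ContinuousOn (fun z : ℝ × ℝ => v z.1 z.2) (Icc 0 T ×ˢ univ))
    (hv_pos : ∀ t ∈ Icc 0 T, ∀ y : ℝ, 0 < v t y)
    (hv_lip : ∀ R, ∃ K, ∀ t ∈ Icc 0 T, LipschitzOnWith K (v t) (Icc (-R) R))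
    (b d : ℝ → ℝ) (Kb Kd : NNReal)
    (hb : LipschitzOnWith Kb b (Icc 0 ℓ)) (hb_maps : MapsTo b (Icc 0 ℓ) (Icc 0 ℓ))
    (hd : LipschitzOnWith Kd d (Icc 0 ℓ)) (hd_maps : MapsTo d (Icc 0 ℓ) (Icc 0 ℓ))
    (hbd : ∀ x ∈ Icc 0 ℓ, b x ≤ d x)
    (lam : ℝ → ℝ → ℝ → ℝ)
    (hlam : ContinuousOn (fun z : ℝ × ℝ × ℝ => lam z.1 z.2.1 z.2.2)
      (Icc 0 T ×ˢ (Icc 0 ℓ ×ˢ Ici 0)))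
    (hlam_pos : ∀ t ∈ Icc 0 T, ∀ x ∈ Icc 0 ℓ, ∀ y ∈ Ici (0 : ℝ), 0 < lam t x y)
    (hlam_lip : ∀ R, ∃ K, ∀ t ∈ Icc 0 T,
      LipschitzOnWith K (fun z : ℝ × ℝ => lam t z.1 z.2) (Icc 0 ℓ ×ˢ Icc 0 R))
    (ρ₀ q₀ u₁ u₂ : ℝ → ℝ)
    (hρ₀ : MemLp ρ₀ ⊤ (volume.restrict (Icc (0 : ℝ) ℓ)))
    (hq₀ : MemLp q₀ ⊤ (volume.restrict (Icc (0 : ℝ) ℓ)))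
    (hu₁ : MemLp u₁ ⊤ (volume.restrict (Icc (0 : ℝ) T)))
    (hu₂ : MemLp u₂ ⊤ (volume.restrict (Icc (0 : ℝ) T)))
    (hρ₀_nonneg : ∀ᵐ x ∂(volume.restrict (Icc (0 : ℝ) ℓ)), 0 ≤ ρ₀ x)
    (hu₁_nonneg : ∀ᵐ t ∂(volume.restrict (Icc (0 : ℝ) T)), 0 ≤ u₁ t) :
    ∃ ρ q : ℝ → RoadLp ℓ p,
      IsWeakSolution T ℓ v lam b d ρ₀ q₀ u₁ u₂ ρ q ∧
      (∀ ρ' q' : ℝ → RoadLp ℓ p, IsWeakSolution T ℓ v lam b d ρ₀ q₀ u₁ u₂ ρ' q' →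
        EqOn ρ' ρ (Icc 0 T) ∧ EqOn q' q (Icc 0 T)) ∧
      IsEssBounded T ℓ ρ ∧ IsEssBounded T ℓ q ∧
      (∀ t ∈ Icc 0 T, 0 ≤ ρ t) ∧
      ((∀ᵐ x ∂(volume.restrict (Icc (0 : ℝ) ℓ)), 0 ≤ q₀ x) →
        (∀ᵐ t ∂(volume.restrict (Icc (0 : ℝ) T)), 0 ≤ u₂ t) →
        ∀ t ∈ Icc 0 T, 0 ≤ q t) := by
  obtain ⟨ρ, hρ⟩ := RoadTraffic.exists_isBoundedSolution_traffic (p := p) hp hT.le hℓ.le hv hv_pos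
    hv_lip hρ₀ hu₁
  have hρ_nonneg := hρ.nonneg hρ₀_nonneg hu₁_nonneg
  obtain ⟨q, hq, hq_unique⟩ := RoadTraffic.exists_unique_isBoundedSolution_truck hp hT hℓ hlam
    hlam_pos hlam_lip hb hd hb_maps hd_maps hbd hρ.continuousOn (fun t _ => hρ_nonneg t)
    hρ.isEssBounded hq₀ hu₂
  refine ⟨ρ, q, ⟨hρ.continuousOn, hq.continuousOn, hρ.satisfiesWeakly, hq.satisfiesWeakly⟩,
    fun ρ' q' h => ?_, hρ.isEssBounded, hq.isEssBounded, fun t _ => hρ_nonneg t,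
    fun hq₀ hu₂ t _ => hq.nonneg hq₀ hu₂ t⟩
  have hρ' : EqOn ρ' ρ (Icc 0 T) := RoadTraffic.eqOn_of_satisfiesWeakly_traffic hT hℓ hv hv_pos
    hv_lip h.continuous_traffic hρ.continuousOn h.traffic hρ.satisfiesWeakly hρ.isEssBounded
  exact ⟨hρ', hq_unique q' h.continuous_truck (RoadTraffic.WeakForm.congr hT.le hℓ.le h.truck
    (fun t ht x _ => by rw [hρ' ht]) (fun _ _ => .rfl) .rfl .rfl)⟩

theorem mainTheorem5
    (T ℓ : ℝ) (hT : 0 < T) (hℓ : 0 < ℓ)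
    (p : ℝ≥0∞) [Fact (1 ≤ p)] (hp : p ≠ ⊤)
    -- speed of the background traffic
    (v : ℝ → ℝ → ℝ)
    (hv : ContDiffOn ℝ 1 (fun z : ℝ × ℝ => v z.1 z.2) (Icc 0 T ×ˢ univ))
    (hv_pos : ∀ t ∈ Icc 0 T, ∀ y : ℝ, 0 < v t y)
    -- boundaries of the non-local term
    (b d : ℝ → ℝ)
    (hb : ContDiffOn ℝ 1 b (Icc 0 ℓ)) (hb_maps : MapsTo b (Icc 0 ℓ) (Icc 0 ℓ))
    (hd : ContDiffOn ℝ 1 d (Icc 0 ℓ)) (hd_maps : MapsTo d (Icc 0 ℓ) (Icc 0 ℓ))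
    (hbd : ∀ x ∈ Icc 0 ℓ, b x ≤ d x)
    -- speed of the trucks
    (lmin lmax L : ℝ) (hlmin : 0 < lmin) (hlmax : lmin ≤ lmax) (hL : 0 ≤ L)
    (lam : ℝ → ℝ → ℝ → ℝ) (hlam : lam ∈ admissibleSpeeds T ℓ lmin lmax L)
    -- initial data and inflows
    (ρ₀ q₀ u₁ u₂ : ℝ → ℝ)
    (hρ₀ : MemLp ρ₀ ⊤ (volume.restrict (Icc (0 : ℝ) ℓ)))
    (hq₀ : MemLp q₀ ⊤ (volume.restrict (Icc (0 : ℝ) ℓ)))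
    (hu₁ : MemLp u₁ ⊤ (volume.restrict (Icc (0 : ℝ) T)))
    (hu₂ : MemLp u₂ ⊤ (volume.restrict (Icc (0 : ℝ) T)))
    (hρ₀_nonneg : ∀ᵐ x ∂(volume.restrict (Icc (0 : ℝ) ℓ)), 0 ≤ ρ₀ x)
    (hu₁_nonneg : ∀ᵐ t ∂(volume.restrict (Icc (0 : ℝ) T)), 0 ≤ u₁ t) :
    ∃ ρ q : ℝ → RoadLp ℓ p,
      IsWeakSolution T ℓ v lam b d ρ₀ q₀ u₁ u₂ ρ q ∧
      (∀ ρ' q' : ℝ → RoadLp ℓ p, IsWeakSolution T ℓ v lam b d ρ₀ q₀ u₁ u₂ ρ' q' →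
        EqOn ρ' ρ (Icc 0 T) ∧ EqOn q' q (Icc 0 T)) ∧
      IsEssBounded T ℓ ρ ∧ IsEssBounded T ℓ q ∧
      (∀ t ∈ Icc 0 T, 0 ≤ ρ t) ∧
      ((∀ᵐ x ∂(volume.restrict (Icc (0 : ℝ) ℓ)), 0 ≤ q₀ x) →
        (∀ᵐ t ∂(volume.restrict (Icc (0 : ℝ) T)), 0 ≤ u₂ t) →
        ∀ t ∈ Icc 0 T, 0 ≤ q t) := by
  obtain ⟨Kb, hKb⟩ := hb.exists_lipschitzOnWith one_ne_zero (convex_Icc 0 ℓ) isCompact_Icc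
  obtain ⟨Kd, hKd⟩ := hd.exists_lipschitzOnWith one_ne_zero (convex_Icc 0 ℓ) isCompact_Icc
  exact mainTheorem5_general T ℓ hT hℓ p hp v hv.continuousOn hv_pos
    (fun R => RoadTraffic.exists_lipschitzOnWith_right_of_contDiffOn
      (hv.mono (prod_mono_right (subset_univ _))) (convex_Icc 0 T) isCompact_Icc
      (convex_Icc (-R) R) isCompact_Icc)
    b d Kb Kd hKb hb_maps hKd hd_maps hbd lam hlam.1
    (fun t ht x hx y hy => hlmin.trans_le (hlam.2.1 t ht x hx y hy).1)
    (fun R => ⟨_, fun t ht => (RoadTraffic.lipschitzOnWith_of_mem_admissibleSpeeds hlam hL ht).mono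
      (prod_mono_right Icc_subset_Ici_self)⟩)
    ρ₀ q₀ u₁ u₂ hρ₀ hq₀ hu₁ hu₂ hρ₀_nonneg hu₁_nonneg
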